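/- \textbf{Theorem.} Let $\rho\ge 0$, $\zeta>0$, $0<\alpha<1$, $c_1>0$, $c_2,B$ be real constants with $2e(\rho+\frac1\zeta)<1$. There is a constant $D>0$, depending only on $\rho,\zeta,\alpha,c_1,c_2,B$, such that the following holds for every real $\epsilon>0$ and every integer $C'\ge 1$ with $C'\le B/\epsilon$ (that is, $C'=O(\epsilon^{-1})$) and $$\frac{\epsilon C'}{4}\Big(\log_2\big(\rho+\tfrac1\zeta\big)+\log_2(2e)\cdot\tfrac{C'+2}{C'}\Big)<-(1+2\epsilon).$$ Put $\nu=\frac{\epsilon C'}{4}\big(\log_2(\rho+\frac1\zeta)+\log_2(2e)\cdot\frac{C'+2}{C'}\big)+1+2\epsilon$ (so $\nu<0$). For $N,K$ let $L=\lfloor\log_2(N/K)\rfloor$, $r=\lfloor\epsilon\log_2K\rfloor$, $T=\lfloor\zeta K\rfloor$. \emph{Non-adaptive random design:} the items are $0,\dots,N-1$. There are $L+r$ levels. On level $\ell<L$ the nodes are the blocks of items with a common value of $\lfloor i/2^{L-1-\ell}\rfloor$ (a binary tree, whose top nodes are the blocks with common $\lfloor i/2^{L}\rfloor$, and whose leaves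 are the items), and on the last $r$ levels the nodes are the single items. On each level, and $C'$ times independently, each node is put, independently and uniformly at random, into one of $T$ tests; a test contains all the items of the nodes put in it. A test is positive if it contains a defective item, and then each test result is flipped independently with probability $\rho$ (binary symmetric channel). \emph{Density-based estimate $\widehat S$:} a node is claimed defective if more than half of its $C'$ tests on its level are positive. The density of a chain of $r$ nodes is the fraction of them that are claimed defective. In each of $\lfloor L/r\rfloor$ steps, the subtrees of depth $r$ below the nodes kept so far (at first: all top nodes) are examined, and those leaves of these subtrees are kept whose chain in the subtree has density $>\frac12$. Finally, $\widehat S$ consists of the items that lie in nodes kept after the last step and whose chain in the last $r$ levels has density $>\frac12$. \emph{Claim.} There are a decoding program, a constant $c$, and constants $E,N_0$ (all independent of $N,K$) such that for all integers $N\ge N_0$ and $K$ with $c_1N^\alpha\le K\le c_2N^\alpha$: (1) the number of tests $TC'(L+r)$ is at most $\zeta C'K\big(\log_2\frac NK+\epsilon\log_2K\big)$ (with equality when $\zeta K$, $\log_2\frac NK$ and $\epsilon\log_2K$ are integers), and $\zeta C'K\big(\log_2\frac NK+\epsilon\log_2K\big)\le D\,\epsilon^{-1}K\log N$; (2) for every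 set $S$ of at most $K$ defective items (hence also for $S$ chosen at random), with probability at least $1-E\,K^{\nu}$ over the design and the noise, $\widehat S=S$ and the program, given $N,K,L,r,C',T$, the design and the noisy test results, halts after at most $D\,\epsilon^{-2}K^{1+\epsilon}$ steps having output exactly the items of $S$. Here programs run on a word-RAM with words of $c\cdot\ell$ bits, where $\ell$ is the length of $N$ in binary, and unit cost for arithmetic operations modulo the word size, memory accesses, branchings, and for reading the test of a given node, or the result of a given test. -/

import Mathlib

open Real MeasureTheory ProbabilityTheory

/-! ### The repeated-test binary-splitting design

`N` items, levels `0, …, L - 1` of a binary tree below its top nodes, followed by `r` further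
levels without branching.  On every level, every node is put into one of `T` tests, and this is
repeated `C` times. -/

/-- The node containing item `i` on a given level: on level `ℓ < L` a node is a block of
`2 ^ (L - 1 - ℓ)` consecutive items (for `N = 2 ^ n`: the items with a common binary prefix), and on
level `L - 1` and on all the extra levels a node is a single item. -/
def nodeOf (L ℓ : ℕ) {N : ℕ} (i : Fin N) : Fin N :=
  ⟨(i : ℕ) / 2 ^ (L - 1 - ℓ), lt_of_le_of_lt (Nat.div_le_self _ _) i.2⟩

/-- A test is given by its level, its repetition number and its number in that repetition. -/
abbrev TestIdx (L r C T : ℕ) : Type := Fin (L + r) × Fin C × Fin T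

/-- A realisation of the design: for each level, repetition and node, the test the node is put in. -/
abbrev Design (L r C T N : ℕ) : Type := Fin (L + r) × Fin C × Fin N → Fin T

/-- The noise: `true` where the test result is flipped. -/
abbrev Noise (L r C T : ℕ) : Type := TestIdx L r C T → Bool

/-- The test matrix: a test contains all the items of the nodes that were put in it. -/
def testMatrix {L r C T N : ℕ} (d : Design L r C T N) : Matrix (TestIdx L r C T) (Fin N) Bool :=
  fun t i => decide (d (t.1, t.2.1, nodeOf L t.1 i) = t.2.2)

/-- The noiseless result of a test: the disjunction over `i` of `A t i ∧ x i`, where `x` is the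
indicator vector of the defective set `S`. -/
def noiselessResult {τ : Type*} {N : ℕ} (A : Matrix τ (Fin N) Bool) (S : Finset (Fin N)) (t : τ) :
    Bool :=
  decide (∃ i, A t i = true ∧ i ∈ S)

/-- The observed result of a test: the noiseless one, flipped where the noise says so. -/
def observed {L r C T N : ℕ} (d : Design L r C T N) (z : Noise L r C T) (S : Finset (Fin N))
    (t : TestIdx L r C T) : Bool :=
  xor (noiselessResult (testMatrix d) S t) (z t)

/-- The law of a single flip in the binary symmetric channel with flipping probability `ρ`. -/
noncomputable def flipLaw (ρ : ℝ) : Measure Bool :=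
  ENNReal.ofReal ρ • Measure.dirac true + ENNReal.ofReal (1 - ρ) • Measure.dirac false

/-- The joint law of design and noise: independent uniform choices of tests for all nodes, and
independent flips, independent of the design. -/
noncomputable def schemeLaw (ρ : ℝ) (L r C T N : ℕ) :
    Measure (Design L r C T N × Noise L r C T) :=
  (Measure.pi fun _ => uniformOn Set.univ).prod (Measure.pi fun _ => flipLaw ρ)

/-! ### Density-based subtree decoding of depth `r` -/

section Density

variable {L r C T N : ℕ}

/-- A node is claimed defective if more than half of its `C` tests on its level are positive. -/
def ClaimedDefective (d : Design L r C T N) (y : TestIdx L r C T → Bool) (ℓ : Fin (L + r))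
    (u : Fin N) : Prop :=
  C < 2 * (Finset.univ.filter fun j : Fin C => y (ℓ, j, d (ℓ, j, u)) = true).card

open Classical in
/-- The multiplicity at the end of the chain of length `r` of the nodes that contain item `i` on the
levels `a, …, a + r - 1`: the number of nodes of the chain that are claimed defective. -/
noncomputable def chainMultiplicity (d : Design L r C T N) (y : TestIdx L r C T → Bool) (a : ℕ)
    (i : Fin N) : ℕ :=
  (Finset.univ.filter fun ℓ : Fin (L + r) =>
    a ≤ (ℓ : ℕ) ∧ (ℓ : ℕ) < a + r ∧ ClaimedDefective d y ℓ (nodeOf L ℓ i)).card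

/-- The density: multiplicity divided by the length of the chain. -/
noncomputable def density (d : Design L r C T N) (y : TestIdx L r C T → Bool) (a : ℕ)
    (i : Fin N) : ℝ :=
  (chainMultiplicity d y a i : ℝ) / r

/-- The node that contains item `i` is still possibly defective after `b` steps.  Each step examines
the subtrees of depth `r` of the nodes kept so far, and keeps the leaves of these subtrees with
density greater than `1/2` in the subtree. -/
def PossiblyDefective (d : Design L r C T N) (y : TestIdx L r C T → Bool) : ℕ → Fin N → Prop
  | 0, _ => True
  | b + 1, i => PossiblyDefective d y b i ∧ 1 / 2 < density d y (b * r) i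

open Classical in
/-- The estimate: the items in nodes that are possibly defective after all the `⌊L / r⌋` steps, and
whose chain in the extra levels has density greater than `1/2`. -/
noncomputable def densityEstimate (d : Design L r C T N) (y : TestIdx L r C T → Bool) :
    Finset (Fin N) :=
  Finset.univ.filter fun i => PossiblyDefective d y (L / r) i ∧ 1 / 2 < density d y L i

end Density

/-! ### Decoding programs and their running time

A word-RAM with structured programs.  Words are the natural numbers below `W`, arithmetic is
modulo `W`, and each operation, memory access and branching costs one step. -/

/-- What a decoding program can read: the word bound, for each level, repetition and node the number
of its test, and for each level, repetition and test number the result (`0` or `1`). -/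
structure DecoderInput where
  W : ℕ
  testOf : ℕ → ℕ → ℕ → ℕ
  result : ℕ → ℕ → ℕ → ℕ

inductive BinOp
  | add | sub | mul | div | mod | lt | eq

def BinOp.eval : BinOp → ℕ → ℕ → ℕ
  | .add, a, b => a + b
  | .sub, a, b => a - b
  | .mul, a, b => a * b
  | .div, a, b => a / b
  | .mod, a, b => a % b
  | .lt, a, b => if a < b then 1 else 0
  | .eq, a, b => if a = b then 1 else 0

inductive Expr
  | const (n : ℕ)
  | reg (x : ℕ)
  | bin (o : BinOp) (e f : Expr)
  | load (e : Expr)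
  | testOf (l j u : Expr)
  | result (l j t : Expr)

inductive Prog
  | skip
  | set (x : ℕ) (e : Expr)
  | store (e f : Expr)
  | emit (e : Expr)
  | seq (p q : Prog)
  | ite (e : Expr) (p q : Prog)
  | loop (e : Expr) (p : Prog)

/-- Registers, memory, and the list of the words that have been output. -/
structure MachineState where
  regs : ℕ → ℕ
  mem : ℕ → ℕ
  out : List ℕ

def Expr.eval (I : DecoderInput) (s : MachineState) : Expr → ℕ
  | .const n => n % I.W
  | .reg x => s.regs x
  | .bin o e f => o.eval (e.eval I s) (f.eval I s) % I.W
  | .load e => s.mem (e.eval I s)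
  | .testOf l j u => I.testOf (l.eval I s) (j.eval I s) (u.eval I s) % I.W
  | .result l j t => I.result (l.eval I s) (j.eval I s) (t.eval I s) % I.W

def Expr.cost : Expr → ℕ
  | .const _ => 1
  | .reg _ => 1
  | .bin _ e f => e.cost + f.cost + 1
  | .load e => e.cost + 1
  | .testOf l j u => l.cost + j.cost + u.cost + 1
  | .result l j t => l.cost + j.cost + t.cost + 1

/-- `Runs I p s n s'`: started in the state `s`, the program `p` halts after exactly `n` steps, in
the state `s'`. -/
inductive Runs (I : DecoderInput) : Prog → MachineState → ℕ → MachineState → Prop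
  | skip (s : MachineState) : Runs I .skip s 1 s
  | set (x : ℕ) (e : Expr) (s : MachineState) :
      Runs I (.set x e) s (e.cost + 1) { s with regs := Function.update s.regs x (e.eval I s) }
  | store (e f : Expr) (s : MachineState) :
      Runs I (.store e f) s (e.cost + f.cost + 1)
        { s with mem := Function.update s.mem (e.eval I s) (f.eval I s) }
  | emit (e : Expr) (s : MachineState) :
      Runs I (.emit e) s (e.cost + 1) { s with out := e.eval I s :: s.out }
  | seq {p q : Prog} {s s₁ s₂ : MachineState} {m n : ℕ} :
      Runs I p s m s₁ → Runs I q s₁ n s₂ → Runs I (.seq p q) s (m + n) s₂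
  | ite_true {e : Expr} {p q : Prog} {s s' : MachineState} {n : ℕ} :
      e.eval I s ≠ 0 → Runs I p s n s' → Runs I (.ite e p q) s (e.cost + n + 1) s'
  | ite_false {e : Expr} {p q : Prog} {s s' : MachineState} {n : ℕ} :
      e.eval I s = 0 → Runs I q s n s' → Runs I (.ite e p q) s (e.cost + n + 1) s'
  | loop_true {e : Expr} {p : Prog} {s s₁ s₂ : MachineState} {m n : ℕ} :
      e.eval I s ≠ 0 → Runs I p s m s₁ → Runs I (.loop e p) s₁ n s₂ →
        Runs I (.loop e p) s (e.cost + m + n + 1) s₂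
  | loop_false {e : Expr} {p : Prog} {s : MachineState} :
      e.eval I s = 0 → Runs I (.loop e p) s (e.cost + 1) s

/-- The decoder reads the design and the observed results, with words of `c` times the bit length of
`N`; indices out of range give `0`. -/
def decoderInput {L r C T N : ℕ} (c : ℕ) (d : Design L r C T N) (y : TestIdx L r C T → Bool) :
    DecoderInput where
  W := 2 ^ (c * Nat.size N)
  testOf l j u :=
    if h : l < L + r ∧ j < C ∧ u < N then (d (⟨l, h.1⟩, ⟨j, h.2.1⟩, ⟨u, h.2.2⟩) : ℕ) else 0
  result l j t :=
    if h : l < L + r ∧ j < C ∧ t < T then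
      (y (⟨l, h.1⟩, ⟨j, h.2.1⟩, ⟨t, h.2.2⟩)).toNat
    else 0

/-- Initially the registers `0, …, 5` hold the parameters `N, K, L, r, C, T`, and everything else is
zero. -/
def initState (N K L r C T : ℕ) : MachineState where
  regs x := [N, K, L, r, C, T].getD x 0
  mem _ := 0
  out := []

/-- Given the design `d` and the results `y`, the program `p` halts after at most `b` steps, and the
words it has output are exactly the numbers of the items in `S`. -/
def DecodesWithin {L r C T N : ℕ} (p : Prog) (c K : ℕ) (d : Design L r C T N)
    (y : TestIdx L r C T → Bool) (b : ℝ) (S : Finset (Fin N)) : Prop :=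
  ∃ (n : ℕ) (s : MachineState), Runs (decoderInput c d y) p (initState N K L r C T) n s ∧
    (n : ℝ) ≤ b ∧ s.out.toFinset = S.map Fin.valEmbedding

/-!
All the errors that matter come from one kind of failure.  A test of a node *misleads* if its
observed result differs from whether the node contains a defective item.  For a node without
defective items this requires a flip or a collision with one of at most `K` nodes, so its
probability is at most `ρ + K / T`, and hence at most `p = exp 1 / 2 * (ρ + 1 / ζ)` for large `K`.
Tests on different levels or in different repetitions are independent
(`schemeLaw_forall_wrongTest_le`): for a fixed design the noise gives a box in a product space, and
the sum over all designs factors over levels and repetitions.  Put `h = ⌈r / 2⌉`.  A chain of `r`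
nodes is *bad* if, on some `h` of its levels, at least half of the `h * C` tests mislead, which has
probability at most `2 ^ r * (2 * √p) ^ (h * C)` (`schemeLaw_badChain_le`).

Only few chains matter: the *exposed* ones, for which the node about `r` levels above their start
contains a defective item, or which start close to the top.  For each starting level they have at
most `2 * K * 2 ^ (2 * r)` different last nodes, and the union bound
(`schemeLaw_exposed_badChain_le`, `failure_le`) gives the claimed power of `K`.  The number of
levels is absorbed because the exponent allows `(2 * exp 1) ^ (r / 2)` where `2 ^ r` suffices.

If no exposed chain is bad, then the density-based estimate is exact (`densityEstimate_eq`): by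
induction, the nodes kept after a step lie in nodes that contained a defective item at the start of
that step, so all the chains that are examined next are exposed.

Carrying out these steps literally would take too long: the leaves that share the first half of
their chain with a defective item are kept, so that there can be about `K * 2 ^ (r / 2)` subtrees to
examine.  The program decodes differently.  It walks through the tree and decides for each node it
meets whether one of the chains of length `h` starting there has a majority of positive tests among
all its `h * C` tests.  Where this majority misleads, the chain is the first half of a bad chain, so
the same good event makes this lookahead test exact below nodes that contain defective items
(`nodePasses_iff`).  Hence only these nodes, their children and the top nodes are ever tested, with
at most `2 ^ h` chains for each, and the cost is `K ^ (1 + ε / 2)` up to powers of the logarithm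
(`decoderBound_le_rpow`).
-/

/-! ### Rules for the running time of programs -/

/-- The word-RAM program `p`, started in `s`, halts within `b` steps in a state satisfying `Q`. -/
def HaltsIn (I : DecoderInput) (p : Prog) (s : MachineState) (b : ℕ) (Q : MachineState → Prop) :
    Prop :=
  ∃ n s', Runs I p s n s' ∧ n ≤ b ∧ Q s'

section Rules

variable {I : DecoderInput} {p q : Prog} {s : MachineState} {Q : MachineState → Prop} {b b' : ℕ}

theorem HaltsIn.mono {Q' : MachineState → Prop} (h : HaltsIn I p s b Q) (hb : b ≤ b')
    (hQ : ∀ s', Q s' → Q' s') : HaltsIn I p s b' Q' := by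
  obtain ⟨n, s', h1, h2, h3⟩ := h
  exact ⟨n, s', h1, h2.trans hb, hQ _ h3⟩

theorem HaltsIn.skip (h : Q s) : HaltsIn I .skip s 1 Q := ⟨1, s, .skip s, le_rfl, h⟩

theorem HaltsIn.set {x : ℕ} {e : Expr}
    (h : Q { s with regs := Function.update s.regs x (e.eval I s) }) :
    HaltsIn I (.set x e) s (e.cost + 1) Q := ⟨_, _, .set x e s, le_rfl, h⟩

theorem HaltsIn.emit {e : Expr} (h : Q { s with out := e.eval I s :: s.out }) :
    HaltsIn I (.emit e) s (e.cost + 1) Q := ⟨_, _, .emit e s, le_rfl, h⟩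

theorem HaltsIn.seq (h : HaltsIn I p s b fun s' => HaltsIn I q s' b' Q) :
    HaltsIn I (.seq p q) s (b + b') Q := by
  obtain ⟨n, s', h1, h2, m, s'', h3, h4, h5⟩ := h
  exact ⟨_, _, .seq h1 h3, add_le_add h2 h4, h5⟩

theorem HaltsIn.ite {e : Expr} (h₁ : e.eval I s ≠ 0 → HaltsIn I p s b Q)
    (h₂ : e.eval I s = 0 → HaltsIn I q s b Q) :
    HaltsIn I (.ite e p q) s (e.cost + b + 1) Q := by
  by_cases he : e.eval I s = 0
  · obtain ⟨n, s', h1, h2, h3⟩ := h₂ he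
    exact ⟨_, _, .ite_false he h1, by omega, h3⟩
  · obtain ⟨n, s', h1, h2, h3⟩ := h₁ he
    exact ⟨_, _, .ite_true he h1, by omega, h3⟩

/-- The rule for loops: an invariant `J`, and a variant `m` that bounds the number of rounds. -/
theorem HaltsIn.loop {e : Expr} (J : MachineState → Prop) (m : MachineState → ℕ)
    (hstep : ∀ s, J s → e.eval I s ≠ 0 → HaltsIn I p s b fun s' => J s' ∧ m s' < m s) (s)
    (hs : J s) :
    HaltsIn I (.loop e p) s (m s * (e.cost + b + 1) + (e.cost + 1))
      fun s' => J s' ∧ e.eval I s' = 0 := by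
  induction hk : m s using Nat.strong_induction_on generalizing s with
  | _ k ih =>
    by_cases he : e.eval I s = 0
    · exact ⟨_, _, .loop_false he, by omega, hs, he⟩
    · obtain ⟨n, s', h1, h2, h3, h4⟩ := hstep s hs he
      obtain ⟨n', s'', h5, h6, h7⟩ := ih (m s') (hk ▸ h4) s' h3 rfl
      refine ⟨_, _, .loop_true he h1 h5, ?_, h7⟩
      have : (m s' + 1) * (e.cost + b + 1) ≤ k * (e.cost + b + 1) :=
        Nat.mul_le_mul_right _ (by omega)
      rw [add_mul] at this
      omega

end Rules

/-- The states `s` and `s'` agree on the output and on the registers below `k`.  This is the frame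
condition for a program that writes only to registers from `k` on. -/
def SameBelow (k : ℕ) (s s' : MachineState) : Prop :=
  (∀ x < k, s'.regs x = s.regs x) ∧ s'.out = s.out

theorem SameBelow.refl (k : ℕ) (s : MachineState) : SameBelow k s s := ⟨fun _ _ => rfl, rfl⟩

theorem SameBelow.trans {k k' : ℕ} {s s' s'' : MachineState} (h : SameBelow k s s')
    (h' : SameBelow k' s' s'') (hk : k ≤ k') : SameBelow k s s'' :=
  ⟨fun x hx => (h'.1 x (by omega)).trans (h.1 x hx), h'.2.trans h.2⟩

theorem SameBelow.update {k x v : ℕ} {s s' : MachineState} (h : SameBelow k s s') (hx : k ≤ x) :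
    SameBelow k s { s' with regs := Function.update s'.regs x v } :=
  ⟨fun y hy => (Function.update_of_ne (by omega) _ _).trans (h.1 y hy), h.2⟩

/-! ### Powers of two -/

/-!
The registers above the parameters: `6` lookahead depth, `7` current item, `8` level, `9` answer of
the lookahead test, `10` size of the node, `11` first item of a chain, `12` end of the node, `13`
distance of these first items, `14` number of positive tests, `15` level on the chain, `16`
repetition, `17` and `18` for powers of two.  The deeper a program is nested, the higher are the
registers that it writes to.
-/

/-- Puts the power of two with exponent `e` into register `17`, using register `18`. -/
def powProg (e : Expr) : Prog :=
  .seq (.set 18 e) <| .seq (.set 17 (.const 1)) <|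
    .loop (.reg 18) <|
      .seq (.set 17 (.bin .add (.reg 17) (.reg 17))) (.set 18 (.bin .sub (.reg 18) (.const 1)))

theorem powProg_spec {I : DecoderInput} {e : Expr} {s : MachineState} {m : ℕ}
    (he : e.eval I s = m) (hm : 2 ^ m < I.W) :
    HaltsIn I (powProg e) s (e.cost + 11 * m + 5)
      fun s' => SameBelow 17 s s' ∧ s'.regs 17 = 2 ^ m := by
  have hW : 1 < I.W := lt_of_le_of_lt Nat.one_le_two_pow hm
  refine HaltsIn.mono (b := (e.cost + 1) + (2 + (m * (1 + (4 + 4) + 1) + 2)))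
    (HaltsIn.seq (HaltsIn.set (HaltsIn.seq (HaltsIn.set ?_)))) (by omega) (fun _ h => h)
  have key := HaltsIn.loop (I := I) (e := .reg 18) (b := 4 + 4)
    (p := .seq (.set 17 (.bin .add (.reg 17) (.reg 17))) (.set 18 (.bin .sub (.reg 18) (.const 1))))
    (fun s' => SameBelow 17 s s' ∧ s'.regs 18 ≤ m ∧ s'.regs 17 * 2 ^ (s'.regs 18) = 2 ^ m)
    (fun s' => s'.regs 18) ?_
  · refine HaltsIn.mono (key _ ⟨((SameBelow.refl _ _).update (by norm_num)).update
      (by norm_num), ?_⟩) ?_ ?_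
    · simp [Expr.eval, he, Nat.mod_eq_of_lt hW]
    · simp [Expr.eval, he, Expr.cost]
    · rintro s' ⟨⟨h1, h2, h3⟩, h4⟩
      simp only [Expr.eval] at h4
      exact ⟨h1, by simpa [h4] using h3⟩
  · rintro s' ⟨h1, h2, h3⟩ h4
    simp only [Expr.eval] at h4
    refine HaltsIn.seq (HaltsIn.set (HaltsIn.set ?_))
    obtain ⟨k, hk⟩ := Nat.exists_eq_succ_of_ne_zero h4
    have h5 : s'.regs 17 + s'.regs 17 ≤ 2 ^ m := by
      rw [← h3, hk, pow_succ]
      nlinarith [Nat.one_le_two_pow (n := k)]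
    have h6 : k < 2 ^ m := lt_of_le_of_lt (by omega) (Nat.lt_two_pow_self (n := m))
    have h7 : (k + 1 - 1) % I.W = k := Nat.mod_eq_of_lt (by omega)
    refine ⟨⟨(h1.update (by norm_num)).update (by norm_num), ?_, ?_⟩, ?_⟩
    · simp [Expr.eval, BinOp.eval, hk, Nat.mod_eq_of_lt hW,
        Nat.mod_eq_of_lt (show k < I.W by omega)]
      omega
    · simp [Expr.eval, BinOp.eval, hk, Nat.mod_eq_of_lt hW,
        Nat.mod_eq_of_lt (show k < I.W by omega),
        Nat.mod_eq_of_lt (show s'.regs 17 + s'.regs 17 < I.W by omega)]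
      rw [← h3, hk, pow_succ]; ring
    · simp [Expr.eval, BinOp.eval, hk, Nat.mod_eq_of_lt hW,
        Nat.mod_eq_of_lt (show k < I.W by omega)]

/-! ### Counting the positive tests of a chain -/

/-- Adds the results of the `C` tests of one node on one level to register `14`: the level is in
register `15`, the node is the quotient of the registers `11` and `17`. -/
def levelCountProg : Prog :=
  .seq (.set 16 (.const 0)) <|
    .loop (.bin .lt (.reg 16) (.reg 4)) <|
      .seq (.set 14 (.bin .add (.reg 14) (.result (.reg 15) (.reg 16)
        (.testOf (.reg 15) (.reg 16) (.bin .div (.reg 11) (.reg 17))))))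
        (.set 16 (.bin .add (.reg 16) (.const 1)))

/-- The result, as a number, of the test of node `u` on level `ℓ` in repetition `j`. -/
def readResult (I : DecoderInput) (ℓ j u : ℕ) : ℕ := I.result ℓ j (I.testOf ℓ j u)

theorem levelCountProg_spec {I : DecoderInput} {s : MachineState} {C ℓ x P : ℕ}
    (hT : ∀ ℓ j u, I.testOf ℓ j u < I.W) (hR : ∀ ℓ j u, readResult I ℓ j u ≤ 1)
    (h4 : s.regs 4 = C) (h15 : s.regs 15 = ℓ) (h11 : s.regs 11 = x) (h17 : s.regs 17 = P)
    (hx : x < I.W) (hC : s.regs 14 + C < I.W) :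
    HaltsIn I levelCountProg s (20 * C + 6) fun s' => SameBelow 14 s s' ∧ s'.regs 15 = ℓ ∧
      s'.regs 14 = s.regs 14 + ∑ j ∈ Finset.range C, readResult I ℓ j (x / P) := by
  have key := HaltsIn.loop (I := I) (e := .bin .lt (.reg 16) (.reg 4)) (b := 12 + 4)
    (p := .seq (.set 14 (.bin .add (.reg 14) (.result (.reg 15) (.reg 16)
        (.testOf (.reg 15) (.reg 16) (.bin .div (.reg 11) (.reg 17))))))
        (.set 16 (.bin .add (.reg 16) (.const 1))))
    (fun s' => SameBelow 14 s s' ∧ s'.regs 15 = ℓ ∧ s'.regs 17 = P ∧ s'.regs 16 ≤ C ∧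
      s'.regs 14 = s.regs 14 + ∑ j ∈ Finset.range (s'.regs 16), readResult I ℓ j (x / P))
    (fun s' => C - s'.regs 16) ?_
  · refine HaltsIn.mono (HaltsIn.seq (HaltsIn.set (key _
      ⟨(SameBelow.refl _ _).update (by norm_num), ?_⟩))) ?_ ?_
    · simp [Expr.eval, h15, h17]
    · simp [Expr.eval, Expr.cost]; omega
    · rintro s' ⟨⟨h1, h2, -, h3, h6⟩, h5⟩
      refine ⟨h1, h2, ?_⟩
      have h7 := h1.1 4 (by norm_num)
      have h8 : ¬ s'.regs 16 < C := by
        intro h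
        simp [Expr.eval, BinOp.eval, h7, h4, h] at h5
        omega
      rw [h6, show s'.regs 16 = C by omega]
  · rintro s' ⟨h1, h2, h3, h6, h7⟩ h5
    have h8 := h1.1 4 (by norm_num)
    have h9 := h1.1 11 (by norm_num)
    have h10 : s'.regs 16 < C := by
      by_contra h
      simp [Expr.eval, BinOp.eval, h8, h4, h] at h5
    have hb : ∑ j ∈ Finset.range (s'.regs 16), readResult I ℓ j (x / P) ≤ s'.regs 16 :=
      (Finset.sum_le_sum fun j _ => hR ℓ j _).trans (by simp)
    have hr := hR ℓ (s'.regs 16) (x / P)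
    have hd : x / P < I.W := (Nat.div_le_self _ _).trans_lt hx
    have hr' : I.result ℓ (s'.regs 16) (I.testOf ℓ (s'.regs 16) (x / P))
      = readResult I ℓ (s'.regs 16) (x / P) := rfl
    refine HaltsIn.seq (HaltsIn.set (HaltsIn.set ?_))
    refine ⟨⟨(h1.update (by norm_num)).update (by norm_num), ?_⟩, ?_⟩
    · simp [Expr.eval, BinOp.eval, h2, h3, h9, h11, Nat.mod_eq_of_lt hd,
        Nat.mod_eq_of_lt (hT _ _ _), hr', Nat.mod_eq_of_lt (show 1 < I.W by omega),
        Nat.mod_eq_of_lt (show s'.regs 16 + 1 < I.W by omega),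
        Nat.mod_eq_of_lt (show readResult I ℓ (s'.regs 16) (x / P) < I.W by omega),
        Finset.sum_range_succ]
      refine ⟨h10, ?_⟩
      rw [Nat.mod_eq_of_lt (by omega), h7, add_assoc]
    · simp [Expr.eval, BinOp.eval, Nat.mod_eq_of_lt (show 1 < I.W by omega),
        Nat.mod_eq_of_lt (show s'.regs 16 + 1 < I.W by omega)]
      omega

/-- Puts into register `14` the number of positive tests on the chain of the item in register `11`
along the `h` levels from the one in register `8` on. -/
def chainCountProg : Prog :=
  .seq (.set 14 (.const 0)) <| .seq (.set 15 (.reg 8)) <|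
    .loop (.bin .lt (.reg 15) (.bin .add (.reg 8) (.reg 6))) <|
      .seq (powProg (.bin .sub (.bin .sub (.reg 2) (.const 1)) (.reg 15))) <|
        .seq levelCountProg (.set 15 (.bin .add (.reg 15) (.const 1)))

/-- The number of positive tests on the chain of item `x` along the levels `a, …, a + h - 1`. -/
def positiveCount (I : DecoderInput) (L C h a x : ℕ) : ℕ :=
  ∑ k ∈ Finset.range h, ∑ j ∈ Finset.range C, readResult I (a + k) j (x / 2 ^ (L - 1 - (a + k)))

theorem positiveCount_le {I : DecoderInput} (hR : ∀ ℓ j u, readResult I ℓ j u ≤ 1)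
    (L C h a x : ℕ) : positiveCount I L C h a x ≤ h * C := by
  unfold positiveCount
  refine (Finset.sum_le_sum fun k _ => Finset.sum_le_sum fun j _ => hR _ _ _).trans (by simp)

theorem chainCountProg_spec {I : DecoderInput} {s : MachineState} {L C h a x : ℕ}
    (hT : ∀ ℓ j u, I.testOf ℓ j u < I.W) (hR : ∀ ℓ j u, readResult I ℓ j u ≤ 1)
    (h2 : s.regs 2 = L) (h4 : s.regs 4 = C) (h6 : s.regs 6 = h) (h8 : s.regs 8 = a)
    (h11 : s.regs 11 = x) (hL : 2 ^ L < I.W)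
    (hx : x < I.W) (hC : h * C + a + h + 1 < I.W) :
    HaltsIn I chainCountProg s (h * (11 * L + 20 * C + 30) + 10) fun s' => SameBelow 14 s s' ∧
      s'.regs 14 = positiveCount I L C h a x := by
  have hLW : L < I.W := Nat.lt_two_pow_self.trans hL
  have key := HaltsIn.loop (I := I) (e := .bin .lt (.reg 15) (.bin .add (.reg 8) (.reg 6)))
    (b := (11 * L + 10) + ((20 * C + 6) + 4))
    (p := .seq (powProg (.bin .sub (.bin .sub (.reg 2) (.const 1)) (.reg 15))) <|
        .seq levelCountProg (.set 15 (.bin .add (.reg 15) (.const 1))))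
    (fun s' => SameBelow 14 s s' ∧ ∃ k ≤ h, s'.regs 15 = a + k ∧
      s'.regs 14 = positiveCount I L C k a x)
    (fun s' => a + h - s'.regs 15) ?_
  · refine HaltsIn.mono (HaltsIn.seq (HaltsIn.set (HaltsIn.seq (HaltsIn.set (key _
      ⟨((SameBelow.refl _ _).update (by norm_num)).update (by norm_num), 0, by omega, ?_⟩))))) ?_ ?_
    · simp [Expr.eval, h8, positiveCount]
    · simp [Expr.eval, Expr.cost, h8]
      ring_nf; omega
    · rintro s' ⟨⟨h1, k, hk, h15, h14⟩, h5⟩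
      refine ⟨h1, ?_⟩
      have e8 := h1.1 8 (by norm_num)
      have e6 := h1.1 6 (by norm_num)
      have : ¬ k < h := by
        intro hkh
        simp [Expr.eval, BinOp.eval, e8, e6, h8, h6, h15, hkh,
            Nat.mod_eq_of_lt (show a + h < I.W by omega)] at h5
        omega
      rw [h14, show k = h by omega]
  · rintro s' ⟨h1, k, hk, h15, h14⟩ h5
    have e8 := h1.1 8 (by norm_num)
    have e6 := h1.1 6 (by norm_num)
    have e2 := h1.1 2 (by norm_num)
    have e4 := h1.1 4 (by norm_num)
    have e11 := h1.1 11 (by norm_num)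
    have hkh : k < h := by
      by_contra hc
      simp [Expr.eval, BinOp.eval, e8, e6, h8, h6, h15, hc,
          Nat.mod_eq_of_lt (show a + h < I.W by omega)] at h5
    have hpc := positiveCount_le hR L C k a x
    have hkC : (k + 1) * C ≤ h * C := Nat.mul_le_mul_right _ hkh
    rw [add_mul] at hkC
    refine HaltsIn.seq (HaltsIn.mono (powProg_spec (m := L - 1 - (a + k)) ?_ ?_) ?_ ?_)
    · simp [Expr.eval, BinOp.eval, e2, h2, h15, Nat.mod_eq_of_lt (show 1 < I.W by omega)]
      rw [Nat.mod_eq_of_lt (show L - 1 < I.W by omega), Nat.mod_eq_of_lt (by omega)]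
    · exact (Nat.pow_le_pow_right (by norm_num) (by omega)).trans_lt hL
    · simp [Expr.cost]; omega
    · rintro s₁ ⟨g1, g2⟩
      have g15 := g1.1 15 (by norm_num)
      have g14 := g1.1 14 (by norm_num)
      refine HaltsIn.seq (HaltsIn.mono (levelCountProg_spec (C := C) (ℓ := a + k) (x := x) hT hR
        (by rw [g1.1 4 (by norm_num), e4, h4]) (by rw [g15, h15])
        (by rw [g1.1 11 (by norm_num), e11, h11]) g2 hx (by rw [g14, h14]; omega)) le_rfl ?_)
      rintro s₂ ⟨f1, f15, f14⟩
      refine HaltsIn.set ⟨⟨((h1.trans g1 (by norm_num)).trans f1 le_rfl).update (by norm_num),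
        k + 1, by omega, ?_, ?_⟩, ?_⟩
      · simp [Expr.eval, BinOp.eval, f15, Nat.mod_eq_of_lt (show 1 < I.W by omega), ← add_assoc,
          Nat.mod_eq_of_lt (show a + k + 1 < I.W by omega)]
      · simp [f14, g14, h14, positiveCount, Finset.sum_range_succ]
      · simp [Expr.eval, BinOp.eval, f15, Nat.mod_eq_of_lt (show 1 < I.W by omega),
          Nat.mod_eq_of_lt (show a + k + 1 < I.W by omega)]
        omega

/-! ### The lookahead test as a program -/

/-- Decides whether the node that contains item `i` (register `7`) on level `a` (register `8`)
passes the lookahead test.  Register `9` receives the answer, register `10` the size of the node. -/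
def nodeTestProg : Prog :=
  .seq (powProg (.bin .sub (.bin .sub (.reg 2) (.const 1)) (.reg 8))) <|
  .seq (.set 10 (.reg 17)) <|
  .seq (.set 11 (.bin .mul (.bin .div (.reg 7) (.reg 10)) (.reg 10))) <|
  .seq (.set 12 (.bin .add (.reg 11) (.reg 10))) <|
  .seq (powProg (.bin .sub (.bin .sub (.reg 2) (.reg 8)) (.reg 6))) <|
  .seq (.set 13 (.reg 17)) <|
  .seq (.set 9 (.const 0)) <|
    .loop (.bin .mul (.bin .lt (.reg 11) (.reg 0)) (.bin .lt (.reg 11) (.reg 12))) <|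
      .seq chainCountProg <|
      .seq (.ite (.bin .lt (.bin .mul (.reg 6) (.reg 4)) (.bin .add (.reg 14) (.reg 14)))
        (.set 9 (.const 1)) .skip)
        (.set 11 (.bin .add (.reg 11) (.reg 13)))

/-- The chain of item `x` along the levels `a, …, a + h - 1` has a majority of positive tests. -/
def ChainPasses (I : DecoderInput) (L C h a x : ℕ) : Prop :=
  h * C < 2 * positiveCount I L C h a x

/-- The lookahead test for the node of item `i` on level `a`: one of the chains of length `h` that
start there has a majority of positive tests.  Each chain is represented by its first item. -/
def NodePasses (I : DecoderInput) (N L C h a i : ℕ) : Prop :=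
  ∃ x < N, 2 ^ (L - a - h) ∣ x ∧ x / 2 ^ (L - 1 - a) = i / 2 ^ (L - 1 - a) ∧
    ChainPasses I L C h a x

/-- The words are long enough for the decoder, and what it reads is as expected. -/
structure Adequate (I : DecoderInput) (N L C h : ℕ) : Prop where
  testOf_lt : ∀ ℓ j u, I.testOf ℓ j u < I.W
  read_le : ∀ ℓ j u, readResult I ℓ j u ≤ 1
  word : 2 * N + 2 * 2 ^ L + 2 * (h * C) + h + L + C + 4 < I.W

/-- The registers hold the parameters, the lookahead depth and the current item. -/
def Params (N L C h i : ℕ) (s : MachineState) : Prop :=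
  s.regs 0 = N ∧ s.regs 2 = L ∧ s.regs 4 = C ∧ s.regs 6 = h ∧ s.regs 7 = i

theorem Params.mono {N L C h i k : ℕ} {s s' : MachineState} (hp : Params N L C h i s)
    (hs : SameBelow k s s') (hk : 8 ≤ k) : Params N L C h i s' := by
  obtain ⟨h0, h2, h4, h6, h7⟩ := hp
  exact ⟨by rw [hs.1 0 (by omega), h0], by rw [hs.1 2 (by omega), h2],
    by rw [hs.1 4 (by omega), h4], by rw [hs.1 6 (by omega), h6], by rw [hs.1 7 (by omega), h7]⟩

/-- A bound for the cost of one lookahead test. -/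
def nodeTestCost (L C h : ℕ) : ℕ := 2 ^ h * (h * (11 * L + 20 * C + 30) + 40) + 22 * L + 60

theorem nodeTestProg_spec {I : DecoderInput} {N L C h a i : ℕ} (hA : Adequate I N L C h)
    {s : MachineState} (hp : Params N L C h i s) (ha : s.regs 8 = a) (haL : a < L) (hh : 0 < h)
    (hi : i < N) :
    HaltsIn I nodeTestProg s (nodeTestCost L C h) fun s' => SameBelow 9 s s' ∧
      s'.regs 10 = 2 ^ (L - 1 - a) ∧ s'.regs 9 ≤ 1 ∧
      (s'.regs 9 ≠ 0 ↔ NodePasses I N L C h a i) := by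
  have hW := hA.word
  obtain ⟨h0, h2, h4, h6, h7⟩ := hp
  set B := 2 ^ (L - 1 - a) with hB
  set D := 2 ^ (L - a - h) with hD
  have hBL : B ≤ 2 ^ L := Nat.pow_le_pow_right (by norm_num) (by omega)
  have hDL : D ≤ 2 ^ L := Nat.pow_le_pow_right (by norm_num) (by omega)
  have hDB : D ∣ B := pow_dvd_pow 2 (by omega)
  have hB0 : 0 < B := by positivity
  have hD0 : 0 < D := by positivity
  have hBD : B ≤ 2 ^ h * D := by
    rw [hB, hD, ← pow_add]; exact Nat.pow_le_pow_right (by norm_num) (by omega)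
  set st := i / B * B with hst
  have hsti : st ≤ i := Nat.div_mul_le_self i B
  have hblk : ∀ x, x / B = i / B ↔ st ≤ x ∧ x < st + B := fun x => by
    rw [Nat.div_eq_iff hB0, ← hst]; omega
  have w1 : (1 : ℕ) % I.W = 1 := Nat.mod_eq_of_lt (by omega)
  -- register `11` runs through the multiples of `D` in the node; the answer so far concerns those
  -- that have been passed
  have key := HaltsIn.loop (I := I)
    (e := .bin .mul (.bin .lt (.reg 11) (.reg 0)) (.bin .lt (.reg 11) (.reg 12)))
    (b := (h * (11 * L + 20 * C + 30) + 10) + (10 + 4))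
    (p := .seq chainCountProg <|
      .seq (.ite (.bin .lt (.bin .mul (.reg 6) (.reg 4)) (.bin .add (.reg 14) (.reg 14)))
        (.set 9 (.const 1)) .skip)
        (.set 11 (.bin .add (.reg 11) (.reg 13))))
    (fun s' => SameBelow 9 s s' ∧ s'.regs 10 = B ∧ s'.regs 12 = st + B ∧ s'.regs 13 = D ∧
      (∃ k, s'.regs 11 = st + k * D) ∧ s'.regs 9 ≤ 1 ∧
      (s'.regs 9 ≠ 0 ↔ ∃ x < s'.regs 11, x < N ∧ D ∣ x ∧ x / B = i / B ∧ ChainPasses I L C h a x))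
    (fun s' => 2 ^ h - (s'.regs 11 - st) / D) ?_
  · refine HaltsIn.mono (b := (5 + 11 * L + 5) + (2 + (6 + (4 + ((5 + 11 * L + 5) + (2 + (2 +
      (2 ^ h * (h * (11 * L + 20 * C + 30) + 10 + 14 + 8) + 8)))))))) ?_ ?_ (fun _ h => h)
    · refine HaltsIn.seq (HaltsIn.mono (powProg_spec (m := L - 1 - a) ?_ ?_) ?_ ?_)
      · simp [Expr.eval, BinOp.eval, h2, ha, w1]
        rw [Nat.mod_eq_of_lt (show L - 1 < I.W by omega), Nat.mod_eq_of_lt (by omega)]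
      · omega
      · simp [Expr.cost]; omega
      rintro s₁ ⟨g1, g17⟩
      refine HaltsIn.seq (HaltsIn.set (HaltsIn.seq (HaltsIn.set (HaltsIn.seq (HaltsIn.set ?_)))))
      have g7 := g1.1 7 (by norm_num)
      have hdiv : i / B ≤ i := Nat.div_le_self _ _
      refine HaltsIn.seq (HaltsIn.mono (powProg_spec (m := L - a - h) ?_ ?_) ?_ ?_)
      · simp [Expr.eval, BinOp.eval, g1.1 2, g1.1 8, g1.1 6, h2, ha, h6]
        rw [Nat.mod_eq_of_lt (show L - a < I.W by omega), Nat.mod_eq_of_lt (by omega)]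
      · omega
      · simp [Expr.cost]; omega
      rintro s₂ ⟨f1, f17⟩
      have f10 := f1.1 10 (by norm_num)
      have f11 := f1.1 11 (by norm_num)
      have f12 := f1.1 12 (by norm_num)
      simp [Expr.eval, BinOp.eval, g17, g7, h7, ← hB, Nat.mod_eq_of_lt (show i / B < I.W by omega),
        ← hst, Nat.mod_eq_of_lt (show st < I.W by omega),
        Nat.mod_eq_of_lt (show st + B < I.W by omega)] at f10 f11 f12
      refine HaltsIn.seq (HaltsIn.set (HaltsIn.seq (HaltsIn.set ?_)))
      refine HaltsIn.mono (key _ ?_) ?_ ?_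
      · refine ⟨?_, ?_⟩
        · refine SameBelow.update (SameBelow.update ?_ (by norm_num)) (by norm_num)
          exact SameBelow.trans (((((SameBelow.refl 9 s).trans g1 (by norm_num)).update
            (by norm_num)).update (by norm_num)).update (by norm_num)) f1 (by norm_num)
        · simp [Expr.eval, f10, f11, f12, f17, ← hD]
          intro x hx _ _ hxi
          have := (hblk x).1 hxi
          omega
      · simp [Expr.eval, f11, Expr.cost]
        omega
      · rintro s' ⟨⟨q1, q10, q12, q13, ⟨k, q11⟩, q9, q9'⟩, q⟩
        refine ⟨q1, q10, q9, q9'.trans ⟨fun ⟨x, _, hx⟩ => ⟨x, hx⟩, fun ⟨x, hx⟩ => ⟨x, ?_, hx⟩⟩⟩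
        by_contra hc
        have e0 := q1.1 0 (by norm_num)
        obtain ⟨hx1, hx2, hx3, hx4⟩ := hx
        have : x < st + B := ((hblk x).1 hx3).2
        simp [Expr.eval, BinOp.eval, e0, h0, q12, show s'.regs 11 < N by omega,
          show s'.regs 11 < st + B by omega, w1] at q
    · unfold nodeTestCost
      ring_nf; omega
  · rintro s₁ ⟨q1, q10, q12, q13, ⟨k, q11⟩, q9, q9'⟩ q
    have e0 := q1.1 0 (by norm_num)
    have e2 := q1.1 2 (by norm_num)
    have e4 := q1.1 4 (by norm_num)
    have e6 := q1.1 6 (by norm_num)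
    have e8 := q1.1 8 (by norm_num)
    have hx : s₁.regs 11 < N ∧ s₁.regs 11 < st + B := by
      by_contra hc
      rw [not_and_or] at hc
      rcases hc with hc | hc <;> simp [Expr.eval, BinOp.eval, e0, h0, q12, hc] at q
    obtain ⟨x, hxdef⟩ : ∃ x, x = s₁.regs 11 := ⟨_, rfl⟩
    rw [← hxdef] at hx q11 q9'
    refine HaltsIn.seq (HaltsIn.mono (chainCountProg_spec (L := L) (C := C) (h := h) (a := a)
      (x := x) hA.testOf_lt hA.read_le (e2.trans h2) (e4.trans h4) (e6.trans h6) (e8.trans ha)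
      hxdef.symm (by omega) (by omega) (by omega)) le_rfl ?_)
    rintro s₂ ⟨f1, f14⟩
    have f4 := f1.1 4 (by norm_num)
    have f6 := f1.1 6 (by norm_num)
    have f9 := f1.1 9 (by norm_num)
    have f10 := f1.1 10 (by norm_num)
    have f11 := f1.1 11 (by norm_num)
    have f12 := f1.1 12 (by norm_num)
    have f13 := f1.1 13 (by norm_num)
    have hpc := positiveCount_le hA.read_le L C h a x
    have hsb : SameBelow 9 s s₂ := q1.trans f1 (by norm_num)
    have hkD : k < 2 ^ h := by
      have : k * D < 2 ^ h * D := by omega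
      exact lt_of_mul_lt_mul_right this (Nat.zero_le _)
    have hxD : D ∣ x := by
      rw [q11]; exact Nat.dvd_add (hDB.trans (Dvd.intro_left _ rfl)) (Dvd.intro_left _ rfl)
    have hxB : x / B = i / B := by
      rw [hblk]; omega
    have hval : Expr.eval I s₂ (.bin .lt (.bin .mul (.reg 6) (.reg 4))
        (.bin .add (.reg 14) (.reg 14))) ≠ 0 ↔ ChainPasses I L C h a x := by
      unfold ChainPasses
      simp only [Expr.eval, BinOp.eval, f6, e6, h6, f4, e4, h4, f14]
      rw [Nat.mod_eq_of_lt (show h * C < I.W by omega),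
          Nat.mod_eq_of_lt
            (show positiveCount I L C h a x + positiveCount I L C h a x < I.W by omega), two_mul]
      split_ifs with hc <;> simp [hc, w1]
    have hnew : ∀ t, ((∃ y < x + D, y < N ∧ D ∣ y ∧ y / B = i / B ∧ ChainPasses I L C h a y) ↔ t) ↔
        ((s₁.regs 9 ≠ 0 ∨ ChainPasses I L C h a x) ↔ t) := by
      intro t
      suffices (∃ y < x + D, y < N ∧ D ∣ y ∧ y / B = i / B ∧ ChainPasses I L C h a y) ↔
        (s₁.regs 9 ≠ 0 ∨ ChainPasses I L C h a x) by rw [this]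
      rw [q9']
      constructor
      · rintro ⟨y, hy, hy'⟩
        rcases lt_or_ge y x with hyx | hyx
        · exact Or.inl ⟨y, hyx, hy'⟩
        · have : y = x := by
            obtain ⟨u, rfl⟩ := hxD
            obtain ⟨v, rfl⟩ := hy'.2.1
            have h1 : u ≤ v := le_of_mul_le_mul_left hyx hD0
            have h2 : v < u + 1 := lt_of_mul_lt_mul_left (a := D) (by rw [mul_add]; omega) hD0.le
            rw [show u = v by omega]
          exact Or.inr (this ▸ hy'.2.2.2)
      · rintro (⟨y, hy, hy'⟩ | hc)
        · exact ⟨y, by omega, hy'⟩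
        · exact ⟨x, by omega, hx.1, hxD, hxB, hc⟩
    have hm : 2 ^ h - (x + D - st) / D < 2 ^ h - (x - st) / D := by
      rw [q11, show st + k * D + D - st = (k + 1) * D by rw [add_mul]; omega,
        show st + k * D - st = k * D by omega, Nat.mul_div_cancel _ hD0, Nat.mul_div_cancel _ hD0]
      omega
    refine HaltsIn.seq (HaltsIn.ite (b := 2) (fun hc => HaltsIn.set (HaltsIn.set ?_))
      (fun hc => HaltsIn.mono (HaltsIn.skip (HaltsIn.set ?_)) (by norm_num) (fun _ h => h)))
    · rw [hval] at hc
      refine ⟨⟨(hsb.update (by norm_num)).update (by norm_num), ?_⟩, ?_⟩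
      · simp [Expr.eval, BinOp.eval, f10, f11, f12, f13, q10, q12, q13, ← hxdef, w1,
          Nat.mod_eq_of_lt (show x + D < I.W by omega)]
        refine ⟨⟨k + 1, by rw [q11]; ring⟩, x, by omega, hx.1, hxD, hxB, hc⟩
      · simpa [Expr.eval, BinOp.eval, f11, f13, q13, ← hxdef,
          Nat.mod_eq_of_lt (show x + D < I.W by omega)] using hm
    · have hc' : ¬ ChainPasses I L C h a x := fun h => (hval.2 h) hc
      refine ⟨⟨(hsb.update (by norm_num)), ?_⟩, ?_⟩
      · have hv : ((Expr.reg 11).bin BinOp.add (Expr.reg 13)).eval I s₂ = x + D := by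
          simp only [Expr.eval, BinOp.eval, f11, f13, q13, ← hxdef]
          exact Nat.mod_eq_of_lt (by omega)
        simp only [hv, Function.update_self, ne_eq, Nat.reduceEqDiff, not_false_eq_true,
          Function.update_of_ne, f9, f10, f12, f13, q10, q12, q13, true_and]
        refine ⟨⟨k + 1, by rw [q11]; ring⟩, q9, ?_⟩
        rw [Iff.comm, hnew]
        simp [hc']
      · simpa [Expr.eval, BinOp.eval, f11, f13, q13, ← hxdef,
          Nat.mod_eq_of_lt (show x + D < I.W by omega)] using hm

/-! ### The decoding program -/

/-- Descends from the top node of the current item as long as the nodes pass the lookahead test.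
Register `8` receives the level of the first node that fails, or `L` if none does. -/
def descendProg : Prog :=
  .seq (.set 8 (.const 0)) <| .seq (.set 9 (.const 1)) <|
    .loop (.bin .mul (.bin .lt (.reg 8) (.reg 2)) (.reg 9)) <|
      .seq nodeTestProg (.ite (.reg 9) (.set 8 (.bin .add (.reg 8) (.const 1))) .skip)

/-- A bound for the cost of one descent. -/
def descendCost (L C h : ℕ) : ℕ := (L + 1) * (nodeTestCost L C h + 12) + 10

theorem descendProg_spec {I : DecoderInput} {N L C h i : ℕ} (hA : Adequate I N L C h)
    {s : MachineState} (hp : Params N L C h i s) (hh : 0 < h) (hi : i < N) :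
    HaltsIn I descendProg s (descendCost L C h) fun s' => SameBelow 8 s s' ∧ ∃ a ≤ L,
      s'.regs 8 = a ∧ (∀ a' < a, NodePasses I N L C h a' i) ∧
      (a < L → ¬ NodePasses I N L C h a i ∧ s'.regs 10 = 2 ^ (L - 1 - a)) := by
  have hW := hA.word
  have w1 : (1 : ℕ) % I.W = 1 := Nat.mod_eq_of_lt (by omega)
  have key := HaltsIn.loop (I := I) (e := .bin .mul (.bin .lt (.reg 8) (.reg 2)) (.reg 9))
    (b := nodeTestCost L C h + 6)
    (p := .seq nodeTestProg (.ite (.reg 9) (.set 8 (.bin .add (.reg 8) (.const 1))) .skip))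
    (fun s' => SameBelow 8 s s' ∧ s'.regs 9 ≤ 1 ∧ ∃ a ≤ L,
      s'.regs 8 = a ∧ (∀ a' < a, NodePasses I N L C h a' i) ∧
      (s'.regs 9 = 0 → a < L ∧ ¬ NodePasses I N L C h a i ∧ s'.regs 10 = 2 ^ (L - 1 - a)))
    (fun s' => (L - s'.regs 8) + s'.regs 9) ?_
  · refine HaltsIn.mono (HaltsIn.seq (HaltsIn.set (HaltsIn.seq (HaltsIn.set (key _
      ⟨((SameBelow.refl _ _).update (by norm_num)).update (by norm_num), ?_, 0, by omega, ?_⟩)))))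
      ?_ ?_
    · simp [Expr.eval, w1]
    · simp [Expr.eval, w1]
    · simp [Expr.eval, Expr.cost, w1, descendCost]
      apply le_of_eq; ring
    · rintro s' ⟨⟨h1, h9, a, haL, h8, hpass, hfail⟩, h5⟩
      refine ⟨h1, a, haL, h8, hpass, fun ha => ?_⟩
      refine (hfail ?_).2
      have e2 := (h1.1 2 (by norm_num)).trans hp.2.1
      simp [Expr.eval, BinOp.eval, e2, h8, ha, w1] at h5
      rwa [Nat.mod_eq_of_lt (by omega)] at h5
  · rintro s₁ ⟨h1, h9, a, haL, h8, hpass, hfail⟩ h5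
    have e2 := (h1.1 2 (by norm_num)).trans hp.2.1
    have ha : a < L ∧ s₁.regs 9 ≠ 0 := by
      constructor
      · by_contra hc; simp [Expr.eval, BinOp.eval, e2, h8, hc] at h5
      · intro hc; simp [Expr.eval, BinOp.eval, e2, h8, hc] at h5
    refine HaltsIn.mono (HaltsIn.seq (b' := 1 + 4 + 1)
      (HaltsIn.mono (nodeTestProg_spec hA (hp.mono h1 le_rfl) h8 ha.1 hh hi)
      le_rfl ?_)) le_rfl (fun _ h => h)
    rintro s₂ ⟨g1, g10, g9, g⟩
    have g8 := (g1.1 8 (by norm_num)).trans h8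
    refine HaltsIn.ite (fun hc => HaltsIn.set ?_)
      (fun hc => HaltsIn.mono (HaltsIn.skip ?_) (by norm_num) (fun _ h => h))
    · simp only [Expr.eval] at hc
      have hv : ((Expr.reg 8).bin BinOp.add (Expr.const 1)).eval I s₂ = a + 1 := by
        simp only [Expr.eval, BinOp.eval, g8, w1]; exact Nat.mod_eq_of_lt (by omega)
      refine ⟨⟨(h1.trans g1 (by norm_num)).update (by norm_num), ?_, a + 1, ha.1, ?_, ?_, ?_⟩, ?_⟩
      · simpa using g9
      · simp [hv]
      · intro a' ha'
        rcases Nat.lt_succ_iff_lt_or_eq.1 ha' with h | rfl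
        · exact hpass _ h
        · exact g.1 hc
      · simp [hc]
      · simp only [hv]; simp; omega
    · simp only [Expr.eval] at hc
      refine ⟨⟨h1.trans g1 (by norm_num), g9, a, haL, g8, hpass,
        fun _ => ⟨ha.1, fun h => g.2 h hc, g10⟩⟩, ?_⟩
      simp only [h8, g8, hc]; omega

/-- The decoder runs through the items in increasing order.  It descends from the top to the current
item; an item all of whose nodes pass the lookahead test is output, and otherwise all the items of
the first node that fails are skipped. -/
def decoderProg : Prog :=
  .seq (.set 6 (.bin .div (.bin .add (.reg 3) (.const 1)) (.const 2))) <|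
  .seq (.set 7 (.const 0)) <|
    .loop (.bin .lt (.reg 7) (.reg 0)) <|
      .seq descendProg <|
        .ite (.bin .eq (.reg 8) (.reg 2))
          (.seq (.emit (.reg 7)) (.set 7 (.bin .add (.reg 7) (.const 1))))
          (.set 7 (.bin .mul (.bin .add (.bin .div (.reg 7) (.reg 10)) (.const 1)) (.reg 10)))

/-- The node of item `i` on level `a` contains an item of `S`. -/
def BlockMeets (L : ℕ) (S : Finset ℕ) (a i : ℕ) : Prop :=
  ∃ s ∈ S, s / 2 ^ (L - 1 - a) = i / 2 ^ (L - 1 - a)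

/-- The ends of the nodes that the decoder can jump over: the items of `S`, the top nodes, and the
children of nodes that contain an item of `S`. -/
def jumpTargets (N L : ℕ) (S : Finset ℕ) : Finset ℕ :=
  S.image (· + 1) ∪ (Finset.range (N / 2 ^ (L - 1) + 1)).image (fun v => (v + 1) * 2 ^ (L - 1)) ∪
    ((Finset.range L ×ˢ S) ×ˢ Finset.range 2).image
      (fun q => (2 * (q.1.2 / 2 ^ (L - 1 - q.1.1)) + q.2 + 1) * 2 ^ (L - 1 - (q.1.1 + 1)))

theorem card_jumpTargets_le (N L : ℕ) (S : Finset ℕ) :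
    (jumpTargets N L S).card ≤ S.card + (N / 2 ^ (L - 1) + 1) + L * S.card * 2 := by
  refine (Finset.card_union_le _ _).trans (add_le_add ((Finset.card_union_le _ _).trans
    (add_le_add Finset.card_image_le ?_)) ?_)
  · exact Finset.card_image_le.trans (by simp)
  · exact Finset.card_image_le.trans (by simp)

/-- If the descent to item `i` stops on level `a`, then the next item to be considered is one of the
jump targets; their number bounds the number of rounds. -/
theorem jump_mem_jumpTargets {N L a i : ℕ} {S : Finset ℕ} (hi : i < N) (ha : a < L)
    (h : ∀ a' < a, BlockMeets L S a' i) :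
    (i / 2 ^ (L - 1 - a) + 1) * 2 ^ (L - 1 - a) ∈ jumpTargets N L S := by
  unfold jumpTargets
  rcases a with _ | a
  · refine Finset.mem_union_left _ (Finset.mem_union_right _ (Finset.mem_image.2 ⟨i / 2 ^ (L - 1),
      ?_, rfl⟩))
    exact Finset.mem_range.2 (Nat.lt_succ_of_le (Nat.div_le_div_right hi.le))
  · obtain ⟨s, hs, hsi⟩ := h a (Nat.lt_succ_self a)
    refine Finset.mem_union_right _ (Finset.mem_image.2
      ⟨((a, s), i / 2 ^ (L - 1 - (a + 1)) % 2), ?_, ?_⟩)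
    · simp only [Finset.mem_product, Finset.mem_range]
      exact ⟨⟨by omega, hs⟩, Nat.mod_lt _ (by norm_num)⟩
    · have : i / 2 ^ (L - 1 - a) = i / 2 ^ (L - 1 - (a + 1)) / 2 := by
        rw [Nat.div_div_eq_div_mul, ← pow_succ]; congr 2; omega
      simp only [hsi, this, Nat.div_add_mod]

/-- A bound for the cost of the decoder, in terms of the number `m` of rounds. -/
def decoderCost (L C h m : ℕ) : ℕ := m * (descendCost L C h + 20) + 20

/-- If, below nodes that contain an item of `S`, exactly the nodes that contain an item of `S` pass
the lookahead test, then the decoder outputs exactly `S`. -/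
theorem decoderProg_spec {I : DecoderInput} {N K L r C T : ℕ} {S : Finset ℕ}
    (hA : Adequate I N L C ((r + 1) / 2)) (hr : 0 < r) (hL : 0 < L) (hrW : r + 1 < I.W)
    (hS : ∀ s ∈ S, s < N)
    (hpass : ∀ i < N, ∀ a < L, (∀ a' < a, BlockMeets L S a' i) →
      (NodePasses I N L C ((r + 1) / 2) a i ↔ BlockMeets L S a i)) :
    HaltsIn I decoderProg (initState N K L r C T)
      (decoderCost L C ((r + 1) / 2) (jumpTargets N L S).card) fun s => s.out.toFinset = S := by
  set h := (r + 1) / 2 with hh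
  have hW := hA.word
  have hh0 : 0 < h := by omega
  have w1 : (1 : ℕ) % I.W = 1 := Nat.mod_eq_of_lt (by omega)
  -- what has been output is the part of `S` below the current item, and each round moves this item
  -- on to a larger jump target
  have key := HaltsIn.loop (I := I) (e := .bin .lt (.reg 7) (.reg 0))
    (b := descendCost L C h + 15)
    (p := .seq descendProg <|
        .ite (.bin .eq (.reg 8) (.reg 2))
          (.seq (.emit (.reg 7)) (.set 7 (.bin .add (.reg 7) (.const 1))))
          (.set 7 (.bin .mul (.bin .add (.bin .div (.reg 7) (.reg 10)) (.const 1)) (.reg 10))))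
    (fun s => ∃ i, Params N L C h i s ∧ s.out.toFinset = S.filter (· < i))
    (fun s => ((jumpTargets N L S).filter (s.regs 7 < ·)).card) ?_
  · refine HaltsIn.mono (b := (5 + 1) + (2 + ((jumpTargets N L S).card *
      (3 + (descendCost L C h + 15) + 1) + 4)))
      (HaltsIn.seq (HaltsIn.set (HaltsIn.seq (HaltsIn.set (HaltsIn.mono (key _
      ⟨0, ⟨?_, ?_, ?_, ?_, ?_⟩, ?_⟩) ?_ ?_))))) ?_ (fun _ h => h)
    · simp [initState]
    · simp [initState]
    · simp [initState]
    · simp [initState, Expr.eval, BinOp.eval, w1, Nat.mod_eq_of_lt hrW,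
        Nat.mod_eq_of_lt (show 2 < I.W by omega), ← hh, Nat.mod_eq_of_lt (show h < I.W by omega)]
    · simp [initState, Expr.eval]
    · simp [initState]
    · exact Nat.add_le_add_right (Nat.mul_le_mul_right _ (Finset.card_filter_le _ _)) _
    · rintro s ⟨⟨i, hp, ho⟩, h5⟩
      have : N ≤ i := by
        by_contra hc
        simp [Expr.eval, BinOp.eval, hp.1, hp.2.2.2.2, lt_of_not_ge hc, w1] at h5
      rw [ho, Finset.filter_true_of_mem fun s hs => (hS s hs).trans_le this]
    · unfold decoderCost
      ring_nf; omega
  · rintro s ⟨i, hp, ho⟩ h5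
    have hi : i < N := by
      by_contra hc
      simp [Expr.eval, BinOp.eval, hp.1, hp.2.2.2.2, hc] at h5
    refine HaltsIn.mono (HaltsIn.seq (b' := 3 + 10 + 1) (HaltsIn.mono
      (descendProg_spec hA hp hh0 hi) le_rfl ?_)) (by omega) (fun _ h => h)
    rintro s₁ ⟨h1, a, haL, h8, hps, hfail⟩
    have hp₁ := hp.mono h1 le_rfl
    obtain ⟨e0, e2, e4, e6, e7⟩ := hp₁
    have e7' := hp.2.2.2.2
    have hmeet : ∀ a' < a, BlockMeets L S a' i := by
      intro a'
      induction a' using Nat.strong_induction_on with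
      | _ a' ih =>
        intro ha'
        exact (hpass i hi a' (by omega) fun b hb => ih b hb (by omega)).1 (hps a' ha')
    have hdec : ∀ t, i < t → t ∈ jumpTargets N L S →
        ((jumpTargets N L S).filter (t < ·)).card < ((jumpTargets N L S).filter (i < ·)).card := by
      intro t hit ht
      refine Finset.card_lt_card (Finset.ssubset_iff.2 ⟨t, by simp, ?_⟩)
      intro x hx
      rcases Finset.mem_insert.1 hx with rfl | hx
      · exact Finset.mem_filter.2 ⟨ht, hit⟩
      · exact Finset.mem_filter.2 ⟨(Finset.mem_filter.1 hx).1, hit.trans (Finset.mem_filter.1 hx).2⟩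
    refine HaltsIn.ite (fun hc => ?_) (fun hc => ?_)
    · have haL' : a = L := by
        by_contra hne
        simp [Expr.eval, BinOp.eval, h8, e2, hne] at hc
      have hiS : i ∈ S := by
        obtain ⟨s, hs, hsi⟩ := hmeet (L - 1) (by omega)
        simp at hsi
        exact hsi ▸ hs
      have hv : ∀ s' : MachineState, s'.regs = s₁.regs →
          ((Expr.reg 7).bin BinOp.add (Expr.const 1)).eval I s' = i + 1 := by
        intro s' hs'
        simp only [Expr.eval, BinOp.eval, hs', e7, w1]; exact Nat.mod_eq_of_lt (by omega)
      refine HaltsIn.mono (b := 2 + 4) (HaltsIn.seq (HaltsIn.emit (HaltsIn.set ?_))) (by norm_num)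
        (fun _ h => h)
      rw [hv ⟨s₁.regs, s₁.mem, (Expr.reg 7).eval I s₁ :: s₁.out⟩ rfl]
      refine ⟨⟨i + 1, ⟨by simpa using e0, by simpa using e2, by simpa using e4,
        by simpa using e6, by simp⟩, ?_⟩, ?_⟩
      · simp only [Expr.eval, e7, List.toFinset_cons, h1.2, ho]
        ext x
        simp only [Finset.mem_insert, Finset.mem_filter]
        constructor
        · rintro (rfl | hx)
          · exact ⟨hiS, by omega⟩
          · exact ⟨hx.1, by omega⟩
        · rintro ⟨hx, hxi⟩
          rcases Nat.lt_succ_iff_lt_or_eq.1 hxi with h | h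
          · exact Or.inr ⟨hx, h⟩
          · exact Or.inl h
      · simp only [e7', Function.update_self]
        exact hdec _ (by omega) (Finset.mem_union_left _ (Finset.mem_union_left _
          (Finset.mem_image_of_mem _ hiS)))
    · have haL' : a < L := by
        refine lt_of_le_of_ne haL ?_
        rintro rfl
        simp [Expr.eval, BinOp.eval, h8, e2, w1] at hc
      obtain ⟨hnp, h10⟩ := hfail haL'
      rw [hpass i hi a haL' hmeet] at hnp
      set B := 2 ^ (L - 1 - a) with hB
      have hB0 : 0 < B := by positivity
      have hBL : B ≤ 2 ^ L := Nat.pow_le_pow_right (by norm_num) (by omega)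
      have hlt : i < (i / B + 1) * B := by
        rw [add_mul, one_mul]; exact Nat.lt_div_mul_add hB0
      have hle : (i / B + 1) * B ≤ i + B := by
        rw [add_mul, one_mul]; exact Nat.add_le_add_right (Nat.div_mul_le_self _ _) _
      have hd := Nat.div_le_self i B
      have hv : ((((Expr.reg 7).bin BinOp.div (Expr.reg 10)).bin BinOp.add (Expr.const 1)).bin
          BinOp.mul (Expr.reg 10)).eval I s₁ = (i / B + 1) * B := by
        simp only [Expr.eval, BinOp.eval, e7, w1, h10]
        rw [Nat.mod_eq_of_lt (show i / B < I.W by omega),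
          Nat.mod_eq_of_lt (show i / B + 1 < I.W by omega), Nat.mod_eq_of_lt (by omega)]
      refine HaltsIn.mono (b := 8) (HaltsIn.set ?_) (by norm_num) (fun _ h => h)
      rw [hv]
      refine ⟨⟨_, ⟨by simpa using e0, by simpa using e2, by simpa using e4,
        by simpa using e6, by simp; rfl⟩, ?_⟩, ?_⟩
      · simp only [h1.2, ho]
        refine Finset.filter_congr fun x hx => ⟨fun h => h.trans hlt, fun h => ?_⟩
        by_contra hc
        refine hnp ⟨x, hx, ?_⟩
        rw [← hB, Nat.div_eq_iff hB0]
        have := Nat.div_mul_le_self i B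
        rw [add_mul, one_mul] at h
        omega
      · simp only [e7', Function.update_self]
        exact hdec _ hlt (jump_mem_jumpTargets hi haL' hmeet)

/-! ### The probability that tests mislead -/

/-- A node of level `ℓ` is defective if it contains an item of `S`. -/
def NodeMeets (L ℓ : ℕ) {N : ℕ} (S : Finset (Fin N)) (u : Fin N) : Prop :=
  ∃ s ∈ S, nodeOf L ℓ s = u

/-- The test of node `u` in repetition `j` of level `ℓ` misleads about that node. -/
def WrongTest {L r C T N : ℕ} (d : Design L r C T N) (y : TestIdx L r C T → Bool)
    (S : Finset (Fin N)) (ℓ : Fin (L + r)) (j : Fin C) (u : Fin N) : Prop :=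
  ¬ (y (ℓ, j, d (ℓ, j, u)) = true ↔ NodeMeets L ℓ S u)

theorem flipLaw_singleton_true (ρ : ℝ) : flipLaw ρ {true} = ENNReal.ofReal ρ := by
  simp [flipLaw]

theorem isProbabilityMeasure_flipLaw {ρ : ℝ} (h0 : 0 ≤ ρ) (h1 : ρ ≤ 1) :
    IsProbabilityMeasure (flipLaw ρ) := by
  constructor
  simp [flipLaw]
  rw [← ENNReal.ofReal_add h0 (by linarith)]; simp

theorem isProbabilityMeasure_uniformOn_fin {T : ℕ} (hT : 0 < T) :
    IsProbabilityMeasure (uniformOn (Set.univ : Set (Fin T))) :=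
  have : NeZero T := ⟨hT.ne'⟩
  isProbabilityMeasure_uniformOn Set.finite_univ Set.univ_nonempty

theorem uniformOn_fin_singleton {T : ℕ} (t : Fin T) :
    uniformOn (Set.univ : Set (Fin T)) {t} = (T : ENNReal)⁻¹ := by
  rw [uniformOn_univ, Measure.count_singleton]; simp

theorem isProbabilityMeasure_schemeLaw {ρ : ℝ} (h0 : 0 ≤ ρ) (h1 : ρ ≤ 1) {T : ℕ} (hT : 0 < T)
    (L r C N : ℕ) : IsProbabilityMeasure (schemeLaw ρ L r C T N) := by
  have := isProbabilityMeasure_flipLaw h0 h1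
  have := isProbabilityMeasure_uniformOn_fin hT
  unfold schemeLaw
  infer_instance

/-- Two different nodes are put in the same test by a `1 / T` fraction of all the assignments. -/
theorem card_filter_apply_eq_mul {N T : ℕ} {u v : Fin N} (huv : v ≠ u) :
    (Finset.univ.filter fun e : Fin N → Fin T => e v = e u).card * T = T ^ N := by
  have : Fintype.card ({e : Fin N → Fin T // e v = e u} × Fin T) = Fintype.card (Fin N → Fin T) :=
    Fintype.card_congr
      { toFun := fun q => Function.update q.1.1 v q.2
        invFun := fun e => (⟨Function.update e v (e u), by simp [huv.symm]⟩, e v)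
        left_inv := by
          rintro ⟨⟨e, he⟩, t⟩
          simp [huv.symm, ← he]
        right_inv := fun e => by simp }
  rw [Fintype.card_prod, Fintype.card_subtype] at this
  simpa using this

open Classical in
/-- The average over all assignments of the flip probability plus the indicator of a collision of
the node `u` with one of the nodes in `V`. -/
theorem sum_collision_le {N T : ℕ} (hT : 0 < T) (ρ : ENNReal) (u : Fin N) (V : Finset (Fin N))
    (hu : u ∉ V) :
    ∑ e : Fin N → Fin T, (ρ + if ∃ v ∈ V, e v = e u then 1 else 0) ≤
      (T : ENNReal) ^ N * (ρ + V.card / T) := by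
  rw [Finset.sum_add_distrib, mul_add]
  refine add_le_add (by simp [mul_comm]) ?_
  calc ∑ e : Fin N → Fin T, (if ∃ v ∈ V, e v = e u then (1 : ENNReal) else 0)
      ≤ ∑ e : Fin N → Fin T, ∑ v ∈ V, (if e v = e u then (1 : ENNReal) else 0) := by
        refine Finset.sum_le_sum fun e _ => ?_
        split_ifs with h
        · obtain ⟨v, hv, hvu⟩ := h
          refine le_trans ?_ (Finset.single_le_sum
            (f := fun v => if e v = e u then (1 : ENNReal) else 0) (fun _ _ => zero_le) hv)
          simp [hvu]
        · exact zero_le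
    _ = ∑ v ∈ V, ((Finset.univ.filter fun e : Fin N → Fin T => e v = e u).card : ENNReal) := by
        rw [Finset.sum_comm]; simp
    _ = ∑ v ∈ V, (T : ENNReal) ^ N / T := by
        refine Finset.sum_congr rfl fun v hv => ?_
        rw [ENNReal.eq_div_iff (by simpa using hT.ne') (by simp), mul_comm]
        exact_mod_cast card_filter_apply_eq_mul (T := T) (u := u) (v := v) (fun h => hu (h ▸ hv))
    _ = (T : ENNReal) ^ N * (V.card / T) := by
        simp [div_eq_mul_inv]; ring
    _ ≤ _ := le_rfl

open Classical in
/-- Tests on different levels or in different repetitions are independent: the probability that they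
all mislead about the chosen nodes is at most the corresponding power. -/
theorem schemeLaw_forall_wrongTest_le {ρ : ℝ} (h0 : 0 ≤ ρ) (h1 : ρ ≤ 1) {L r C T N : ℕ} (hT : 0 < T)
    (S : Finset (Fin N)) (u : Fin (L + r) → Fin N) (A : Finset (Fin (L + r) × Fin C)) :
    (schemeLaw ρ L r C T N).real
      {ω | ∀ q ∈ A, WrongTest ω.1 (observed ω.1 ω.2 S) S q.1 q.2 (u q.1)} ≤
      (ρ + S.card / T) ^ A.card := by
  have := isProbabilityMeasure_flipLaw h0 h1
  have := isProbabilityMeasure_uniformOn_fin hT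
  set R := ENNReal.ofReal ρ with hR
  set p : ENNReal := R + S.card / T with hp
  have hpR : p = ENNReal.ofReal (ρ + S.card / T) := by
    rw [ENNReal.ofReal_add h0 (by positivity), ENNReal.ofReal_div_of_pos (by exact_mod_cast hT)]
    simp [hp, hR]
  -- the defective nodes that `u` can collide with; none if `u` is itself defective
  let V : Fin (L + r) → Finset (Fin N) := fun ℓ =>
    if NodeMeets L ℓ S (u ℓ) then ∅ else S.image (nodeOf L ℓ)
  have hV : ∀ ℓ, (V ℓ).card ≤ S.card := by
    intro ℓ
    simp only [V]; split_ifs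
    · simp
    · exact Finset.card_image_le
  have huV : ∀ ℓ, u ℓ ∉ V ℓ := by
    intro ℓ
    simp only [V]; split_ifs with h
    · simp
    · intro hm
      obtain ⟨s, hs, hsu⟩ := Finset.mem_image.1 hm
      exact h ⟨s, hs, hsu⟩
  let g : Fin (L + r) × Fin C → (Fin N → Fin T) → ENNReal := fun q e =>
    if q ∈ A then R + (if ∃ v ∈ V q.1, e v = e (u q.1) then 1 else 0) else 1
  suffices h : schemeLaw ρ L r C T N
      {ω | ∀ q ∈ A, WrongTest ω.1 (observed ω.1 ω.2 S) S q.1 q.2 (u q.1)} ≤ p ^ A.card by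
    rw [Measure.real]
    refine ENNReal.toReal_le_of_le_ofReal (by positivity) ?_
    rwa [ENNReal.ofReal_pow (by positivity), ← hpR]
  unfold schemeLaw
  rw [Measure.prod_apply (MeasurableSet.of_discrete)]
  -- the noise, for a given design
  have hsec : ∀ d : Design L r C T N, (Measure.pi fun _ => flipLaw ρ) (Prod.mk d ⁻¹'
      {ω : Design L r C T N × Noise L r C T | ∀ q ∈ A,
        WrongTest ω.1 (observed ω.1 ω.2 S) S q.1 q.2 (u q.1)}) ≤
      ∏ q, g q (fun v => d (q.1, q.2, v)) := by
    intro d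
    let w : Fin (L + r) × Fin C → Bool := fun q =>
      decide (noiselessResult (testMatrix d) S (q.1, q.2, d (q.1, q.2, u q.1)) = true ↔
        NodeMeets L q.1 S (u q.1))
    let box : TestIdx L r C T → Set Bool := fun t =>
      if (t.1, t.2.1) ∈ A ∧ t.2.2 = d (t.1, t.2.1, u t.1) then {w (t.1, t.2.1)} else Set.univ
    have hbox : (Prod.mk d ⁻¹' {ω : Design L r C T N × Noise L r C T | ∀ q ∈ A,
        WrongTest ω.1 (observed ω.1 ω.2 S) S q.1 q.2 (u q.1)}) ⊆ Set.univ.pi box := by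
      intro z hz t _
      simp only [box]
      split_ifs with ht
      · have := hz _ ht.1
        obtain ⟨ℓ, j, t⟩ := t
        obtain ⟨ht1, ht2⟩ := ht
        dsimp only at ht1 ht2 this
        subst ht2
        simp only [WrongTest, observed] at this
        simp only [Set.mem_singleton_iff, w]
        by_cases hn : NodeMeets L ℓ S (u ℓ) <;>
          cases hnr : noiselessResult (testMatrix d) S (ℓ, j, d (ℓ, j, u ℓ)) <;>
          simp_all
      · trivial
    refine (measure_mono hbox).trans ?_
    rw [Measure.pi_pi, Fintype.prod_prod_type, Fintype.prod_prod_type]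
    refine Finset.prod_le_prod' fun ℓ _ => ?_
    rw [Fintype.prod_prod_type]
    refine Finset.prod_le_prod' fun j _ => ?_
    by_cases hA : (ℓ, j) ∈ A
    · rw [Finset.prod_eq_single (d (ℓ, j, u ℓ))]
      · simp only [box, g, hA, true_and, if_true]
        by_cases hw : noiselessResult (testMatrix d) S (ℓ, j, d (ℓ, j, u ℓ)) = true ↔
          NodeMeets L ℓ S (u ℓ)
        · have : w (ℓ, j) = true := decide_eq_true hw
          rw [this, flipLaw_singleton_true]; exact le_self_add
        · have hcol : ∃ v ∈ V ℓ, d (ℓ, j, v) = d (ℓ, j, u ℓ) := by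
            have hn : ¬ NodeMeets L ℓ S (u ℓ) := by
              intro hn
              refine hw ⟨fun _ => hn, fun _ => ?_⟩
              obtain ⟨s, hs, hsu⟩ := hn
              simp only [noiselessResult, testMatrix, decide_eq_true_eq]
              exact ⟨s, by rw [hsu], hs⟩
            have hr : noiselessResult (testMatrix d) S (ℓ, j, d (ℓ, j, u ℓ)) = true := by
              by_contra hc; exact hw ⟨fun h => absurd h hc, fun h => absurd h hn⟩
            simp only [noiselessResult, testMatrix, decide_eq_true_eq] at hr
            obtain ⟨s, hs, hsS⟩ := hr
            refine ⟨nodeOf L ℓ s, ?_, hs⟩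
            simp only [V, if_neg hn]
            exact Finset.mem_image_of_mem _ hsS
          rw [if_pos hcol]
          exact prob_le_one.trans le_add_self
      · intro t _ ht
        simp [box, ht, -Bool.univ_eq]
      · simp
    · simp [box, g, hA, -Bool.univ_eq]
  refine (lintegral_mono hsec).trans ?_
  rw [lintegral_fintype]
  have hsing : ∀ d : Design L r C T N,
      (Measure.pi fun _ : Fin (L + r) × Fin C × Fin N => uniformOn (Set.univ : Set (Fin T))) {d} =
        ((T : ENNReal)⁻¹) ^ Fintype.card (Fin (L + r) × Fin C × Fin N) := by
    intro d
    rw [← Set.univ_pi_singleton, Measure.pi_pi]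
    simp [uniformOn_fin_singleton]
  simp only [hsing]
  rw [← Finset.sum_mul]
  -- the design: the sum over all designs factors over levels and repetitions
  have hsum : ∑ d : Design L r C T N, ∏ q : Fin (L + r) × Fin C, g q (fun v => d (q.1, q.2, v)) =
      ∏ q : Fin (L + r) × Fin C, ∑ e : Fin N → Fin T, g q e := by
    rw [Finset.prod_univ_sum, Fintype.piFinset_univ]
    exact Fintype.sum_equiv
      { toFun := fun d q v => d (q.1, q.2, v)
        invFun := fun f x => f (x.1, x.2.1) x.2.2
        left_inv := fun _ => rfl
        right_inv := fun _ => rfl } _ _ (fun _ => rfl)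
  rw [hsum]
  have hfac : ∏ q : Fin (L + r) × Fin C, ∑ e : Fin N → Fin T, g q e ≤
      ((T : ENNReal) ^ N) ^ Fintype.card (Fin (L + r) × Fin C) * p ^ A.card := by
    calc _ ≤ ∏ q : Fin (L + r) × Fin C, ((T : ENNReal) ^ N * if q ∈ A then p else 1) := by
          refine Finset.prod_le_prod' fun q _ => ?_
          by_cases hq : q ∈ A
          · simp only [g, hq, if_true]
            refine (sum_collision_le hT R (u q.1) (V q.1) (huV q.1)).trans ?_
            have hVq : ((V q.1).card : ENNReal) ≤ S.card := by exact_mod_cast hV _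
            exact mul_le_mul_right (add_le_add le_rfl (ENNReal.div_le_div_right hVq _)) _
          · simp [g, hq]
      _ = _ := by
          rw [Finset.prod_mul_distrib, Finset.prod_const, Finset.card_univ, Finset.prod_ite_mem,
            Finset.univ_inter, Finset.prod_const]
  refine (mul_le_mul_left hfac _).trans (le_of_eq ?_)
  have hT0 : (T : ENNReal) ≠ 0 := by simpa using hT.ne'
  rw [mul_right_comm, ← pow_mul, show N * Fintype.card (Fin (L + r) × Fin C) =
    Fintype.card (Fin (L + r) × Fin C × Fin N) by simp [Fintype.card_prod]; ring, ← mul_pow,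
    ENNReal.mul_inv_cancel hT0 (by simp), one_pow, one_mul]

/-! ### Bad chains -/

section Chains

variable {L r C T N : ℕ}

open Classical in
/-- At least half of the tests of the nodes of item `i` on the levels in `R` mislead. -/
def WrongMajority (d : Design L r C T N) (y : TestIdx L r C T → Bool) (S : Finset (Fin N))
    (R : Finset (Fin (L + r))) (i : Fin N) : Prop :=
  R.card * C ≤ 2 * ((R ×ˢ Finset.univ).filter fun q : Fin (L + r) × Fin C =>
    WrongTest d y S q.1 q.2 (nodeOf L q.1 i)).card

/-- The levels `a, …, a + len - 1`. -/
def window (L r a len : ℕ) : Finset (Fin (L + r)) :=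
  Finset.univ.filter fun ℓ => a ≤ (ℓ : ℕ) ∧ (ℓ : ℕ) < a + len

theorem mem_window {a len : ℕ} {ℓ : Fin (L + r)} :
    ℓ ∈ window L r a len ↔ a ≤ (ℓ : ℕ) ∧ (ℓ : ℕ) < a + len := by
  simp [window]

theorem map_window {a len : ℕ} (h : a + len ≤ L + r) :
    (window L r a len).map Fin.valEmbedding = Finset.Ico a (a + len) := by
  ext x
  simp only [Finset.mem_map, mem_window, Fin.valEmbedding_apply, Finset.mem_Ico]
  exact ⟨by rintro ⟨ℓ, hℓ, rfl⟩; exact hℓ, fun hx => ⟨⟨x, by omega⟩, hx, rfl⟩⟩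

theorem card_window {a len : ℕ} (h : a + len ≤ L + r) : (window L r a len).card = len := by
  rw [← Finset.card_map Fin.valEmbedding, map_window h, Nat.card_Ico]; omega

/-- On the chain of item `i` of length `r` from level `a` on, there are `⌈r / 2⌉` levels such that
at least half of all the tests on these levels mislead.  Both wrong densities and wrong majorities
among all the tests on the first `⌈r / 2⌉` levels imply this. -/
def BadChain (d : Design L r C T N) (y : TestIdx L r C T → Bool) (S : Finset (Fin N)) (a : ℕ)
    (i : Fin N) : Prop :=
  ∃ R ⊆ window L r a r, R.card = (r + 1) / 2 ∧ WrongMajority d y S R i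

theorem schemeLaw_wrongMajority_le {ρ p : ℝ} (h0 : 0 ≤ ρ) (h1 : ρ ≤ 1) (hT : 0 < T)
    (S : Finset (Fin N)) (hp : ρ + S.card / T ≤ p) (hp1 : p ≤ 1) (R : Finset (Fin (L + r)))
    (i : Fin N) :
    (schemeLaw ρ L r C T N).real {ω | WrongMajority ω.1 (observed ω.1 ω.2 S) S R i} ≤
      (2 * √p) ^ (R.card * C) := by
  classical
  have := isProbabilityMeasure_schemeLaw h0 h1 hT L r C N
  have hp0 : 0 ≤ p := le_trans (by positivity) hp
  set F := (R ×ˢ (Finset.univ : Finset (Fin C))).powerset.filter fun A => R.card * C ≤ 2 * A.card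
  calc _ ≤ (schemeLaw ρ L r C T N).real (⋃ A ∈ F, {ω | ∀ q ∈ A,
          WrongTest ω.1 (observed ω.1 ω.2 S) S q.1 q.2 (nodeOf L q.1 i)}) := by
        refine measureReal_mono (fun ω hω => ?_) (measure_ne_top _ _)
        simp only [Set.mem_ofPred_eq, WrongMajority] at hω
        refine Set.mem_biUnion (x := _) (Finset.mem_filter.2
          ⟨Finset.mem_powerset.2 (Finset.filter_subset _ _), hω⟩) ?_
        exact fun q hq => (Finset.mem_filter.1 hq).2
    _ ≤ ∑ A ∈ F, (schemeLaw ρ L r C T N).real {ω | ∀ q ∈ A,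
          WrongTest ω.1 (observed ω.1 ω.2 S) S q.1 q.2 (nodeOf L q.1 i)} :=
        measureReal_biUnion_finset_le _ _
    _ ≤ ∑ A ∈ F, (√p) ^ (R.card * C) := by
        refine Finset.sum_le_sum fun A hA => ?_
        refine (schemeLaw_forall_wrongTest_le h0 h1 hT S (fun ℓ => nodeOf L ℓ i) A).trans ?_
        calc (ρ + S.card / T) ^ A.card ≤ p ^ A.card := pow_le_pow_left₀ (by positivity) hp _
          _ = (√p) ^ (2 * A.card) := by rw [pow_mul, Real.sq_sqrt hp0]
          _ ≤ _ := pow_le_pow_of_le_one (Real.sqrt_nonneg _) (Real.sqrt_le_one.2 hp1)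
              (Finset.mem_filter.1 hA).2
    _ ≤ _ := by
        rw [Finset.sum_const, nsmul_eq_mul, mul_pow]
        refine mul_le_mul_of_nonneg_right ?_ (by positivity)
        have : F.card ≤ 2 ^ (R.card * C) := by
          refine (Finset.card_filter_le _ _).trans ?_
          simp
        exact_mod_cast this

theorem schemeLaw_badChain_le {ρ p : ℝ} (h0 : 0 ≤ ρ) (h1 : ρ ≤ 1) (hT : 0 < T)
    (S : Finset (Fin N)) (hp : ρ + S.card / T ≤ p) (hp1 : p ≤ 1) {a : ℕ} (ha : a ≤ L)
    (i : Fin N) :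
    (schemeLaw ρ L r C T N).real {ω | BadChain ω.1 (observed ω.1 ω.2 S) S a i} ≤
      2 ^ r * (2 * √p) ^ ((r + 1) / 2 * C) := by
  classical
  have := isProbabilityMeasure_schemeLaw h0 h1 hT L r C N
  have hp0 : 0 ≤ p := le_trans (by positivity) hp
  set F := (window L r a r).powerset.filter fun R => R.card = (r + 1) / 2
  calc _ ≤ (schemeLaw ρ L r C T N).real (⋃ R ∈ F,
          {ω | WrongMajority ω.1 (observed ω.1 ω.2 S) S R i}) := by
        refine measureReal_mono (fun ω hω => ?_) (measure_ne_top _ _)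
        obtain ⟨R, hR, hRc, hRw⟩ := hω
        exact Set.mem_biUnion (x := R) (Finset.mem_filter.2 ⟨Finset.mem_powerset.2 hR, hRc⟩) hRw
    _ ≤ ∑ R ∈ F, (schemeLaw ρ L r C T N).real
          {ω | WrongMajority ω.1 (observed ω.1 ω.2 S) S R i} := measureReal_biUnion_finset_le _ _
    _ ≤ ∑ R ∈ F, (2 * √p) ^ ((r + 1) / 2 * C) := by
        refine Finset.sum_le_sum fun R hR => ?_
        rw [← (Finset.mem_filter.1 hR).2]
        exact schemeLaw_wrongMajority_le h0 h1 hT S hp hp1 R i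
    _ ≤ _ := by
        rw [Finset.sum_const, nsmul_eq_mul]
        refine mul_le_mul_of_nonneg_right ?_ (by positivity)
        have : F.card ≤ 2 ^ r := by
          refine (Finset.card_filter_le _ _).trans ?_
          rw [Finset.card_powerset, card_window (by omega)]
        exact_mod_cast this

/-! ### Counting chains -/

theorem nodeOf_eq_iff {ℓ : ℕ} {i j : Fin N} :
    nodeOf L ℓ i = nodeOf L ℓ j ↔ (i : ℕ) / 2 ^ (L - 1 - ℓ) = j / 2 ^ (L - 1 - ℓ) := by
  simp [nodeOf, Fin.ext_iff]

theorem div_two_pow_eq_of_le {x y m n : ℕ} (hmn : m ≤ n) (h : x / 2 ^ m = y / 2 ^ m) :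
    x / 2 ^ n = y / 2 ^ n := by
  obtain ⟨k, rfl⟩ := Nat.exists_eq_add_of_le hmn
  rw [pow_add, ← Nat.div_div_eq_div_mul, ← Nat.div_div_eq_div_mul, h]

theorem nodeOf_eq_of_le {ℓ ℓ' : ℕ} {i j : Fin N} (hℓ : ℓ' ≤ ℓ) (h : nodeOf L ℓ i = nodeOf L ℓ j) :
    nodeOf L ℓ' i = nodeOf L ℓ' j := by
  rw [nodeOf_eq_iff] at h ⊢
  exact div_two_pow_eq_of_le (by omega) h

theorem NodeMeets.of_le {ℓ ℓ' : ℕ} {S : Finset (Fin N)} {i : Fin N} (hℓ : ℓ' ≤ ℓ)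
    (h : NodeMeets L ℓ S (nodeOf L ℓ i)) : NodeMeets L ℓ' S (nodeOf L ℓ' i) := by
  obtain ⟨s, hs, hsi⟩ := h
  exact ⟨s, hs, nodeOf_eq_of_le hℓ hsi⟩

theorem NodeMeets.of_mem {ℓ : ℕ} {S : Finset (Fin N)} {i : Fin N} (h : i ∈ S) :
    NodeMeets L ℓ S (nodeOf L ℓ i) := ⟨i, h, rfl⟩

theorem nodeOf_of_le {ℓ : ℕ} (h : L - 1 ≤ ℓ) (i : Fin N) : nodeOf L ℓ i = i := by
  ext; simp [nodeOf, show L - 1 - ℓ = 0 by omega]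

theorem nodeMeets_leaf {ℓ : ℕ} (h : L - 1 ≤ ℓ) {S : Finset (Fin N)} {i : Fin N} :
    NodeMeets L ℓ S (nodeOf L ℓ i) ↔ i ∈ S := by
  simp [NodeMeets, nodeOf_of_le h]

/-- Whether a chain is bad depends only on its last node. -/
theorem BadChain.congr {d : Design L r C T N} {y : TestIdx L r C T → Bool} {S : Finset (Fin N)}
    {a : ℕ} {i j : Fin N} (h : (i : ℕ) / 2 ^ (L - a - r) = j / 2 ^ (L - a - r))
    (hb : BadChain d y S a i) : BadChain d y S a j := by
  obtain ⟨R, hR, hRc, hRw⟩ := hb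
  refine ⟨R, hR, hRc, ?_⟩
  unfold WrongMajority at hRw ⊢
  convert hRw using 4 with q hq
  have hq := mem_window.1 (hR (Finset.mem_product.1 hq).1)
  rw [nodeOf_eq_iff.2 (div_two_pow_eq_of_le (by omega) h.symm)]

/-- The level from which the ancestors of a chain are counted: its first level `a`, but at most
`L - r`, since there is no branching from level `L` on. -/
def branchStart (L r a : ℕ) : ℕ := min a (L - r)

/-- The chain of item `i` from level `a` on is exposed if the node of `i` that lies `r` levels above
`branchStart L r a` contains an item of `S`, or if there is at most this distance to the top. -/
def Exposed (L r : ℕ) {N : ℕ} (S : Finset (Fin N)) (a : ℕ) (i : Fin N) : Prop :=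
  branchStart L r a ≤ r ∨
    NodeMeets L (branchStart L r a - r) S (nodeOf L (branchStart L r a - r) i)

/-- A set of numbers that contains those of the last nodes of all the exposed chains from level `a`
on. -/
def exposedEnds (L r : ℕ) {N : ℕ} (S : Finset (Fin N)) (a : ℕ) : Finset ℕ :=
  if branchStart L r a ≤ r then Finset.range (N / 2 ^ (L - a - r) + 1) else
    (S ×ˢ Finset.range (2 ^ (2 * r))).image fun q =>
      (q.1 : ℕ) / 2 ^ (L - 1 - (branchStart L r a - r)) *
        2 ^ (L - 1 - (branchStart L r a - r) - (L - a - r)) + q.2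

theorem mem_exposedEnds (hr : 0 < r) {S : Finset (Fin N)} {a : ℕ} {i : Fin N}
    (h : Exposed L r S a i) : (i : ℕ) / 2 ^ (L - a - r) ∈ exposedEnds L r S a := by
  unfold exposedEnds
  split_ifs with hw
  · exact Finset.mem_range.2 (Nat.lt_succ_of_le (Nat.div_le_div_right i.2.le))
  · obtain ⟨s, hs, hsi⟩ := h.resolve_left hw
    rw [nodeOf_eq_iff] at hsi
    have hm : ∃ k ≤ 2 * r, L - 1 - (branchStart L r a - r) = L - a - r + k := by
      unfold branchStart at hw ⊢
      exact ⟨L - 1 - (min a (L - r) - r) - (L - a - r), by omega, by omega⟩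
    obtain ⟨k, hk, hm⟩ := hm
    rw [hm] at hsi ⊢
    refine Finset.mem_image.2 ⟨(s, i / 2 ^ (L - a - r) % 2 ^ k), ?_, ?_⟩
    · simp only [Finset.mem_product, Finset.mem_range]
      exact ⟨hs, (Nat.mod_lt _ (by positivity)).trans_le (Nat.pow_le_pow_right (by norm_num) hk)⟩
    · simp only [hsi, Nat.add_sub_cancel_left]
      rw [pow_add, ← Nat.div_div_eq_div_mul, mul_comm, Nat.div_add_mod]

theorem card_exposedEnds_le {K : ℕ} {S : Finset (Fin N)} (hS : S.card ≤ K)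
    (hN : N < 2 ^ (L + 1) * K) {a : ℕ} (ha : a ≤ L) :
    (exposedEnds L r S a).card ≤ K * 2 ^ (2 * r + 1) := by
  unfold exposedEnds
  split_ifs with hw
  · rw [Finset.card_range, Nat.succ_le_iff, Nat.div_lt_iff_lt_mul (by positivity), mul_assoc,
      ← pow_add, mul_comm]
    unfold branchStart at hw
    exact hN.trans_le (Nat.mul_le_mul_right _ (Nat.pow_le_pow_right (by norm_num) (by omega)))
  · refine Finset.card_image_le.trans ?_
    rw [Finset.card_product, Finset.card_range]
    exact Nat.mul_le_mul hS (Nat.pow_le_pow_right (by norm_num) (by omega))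

theorem schemeLaw_exposed_badChain_le {ρ p : ℝ} (h0 : 0 ≤ ρ) (h1 : ρ ≤ 1) (hT : 0 < T) {K : ℕ}
    {S : Finset (Fin N)} (hS : S.card ≤ K) (hN : N < 2 ^ (L + 1) * K) (hr : 0 < r)
    (hp : ρ + S.card / T ≤ p) (hp1 : p ≤ 1) :
    (schemeLaw ρ L r C T N).real {ω | ∃ a ≤ L, ∃ i, Exposed L r S a i ∧
      BadChain ω.1 (observed ω.1 ω.2 S) S a i} ≤
      (L + 1) * (K * 2 ^ (2 * r + 1)) * (2 ^ r * (2 * √p) ^ ((r + 1) / 2 * C)) := by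
  have := isProbabilityMeasure_schemeLaw h0 h1 hT L r C N
  set β : ℝ := 2 ^ r * (2 * √p) ^ ((r + 1) / 2 * C)
  have hβ : 0 ≤ β := by positivity
  have hone : ∀ a ≤ L, ∀ e : ℕ, (schemeLaw ρ L r C T N).real {ω | ∃ i : Fin N,
      (i : ℕ) / 2 ^ (L - a - r) = e ∧ BadChain ω.1 (observed ω.1 ω.2 S) S a i} ≤ β := by
    intro a ha e
    by_cases he : ∃ i : Fin N, (i : ℕ) / 2 ^ (L - a - r) = e
    · obtain ⟨i₀, hi₀⟩ := he
      refine le_trans (measureReal_mono ?_ (measure_ne_top _ _))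
        (schemeLaw_badChain_le h0 h1 hT S hp hp1 ha i₀)
      rintro ω ⟨i, hi, hb⟩
      exact hb.congr (hi.trans hi₀.symm)
    · have : {ω : Design L r C T N × Noise L r C T | ∃ i : Fin N, (i : ℕ) / 2 ^ (L - a - r) = e ∧
          BadChain ω.1 (observed ω.1 ω.2 S) S a i} = ∅ := by
        ext ω
        simp only [Set.mem_ofPred_eq, Set.mem_empty_iff_false, iff_false]
        exact fun ⟨i, hi, _⟩ => he ⟨i, hi⟩
      rw [this]; simpa using hβ
  calc _ ≤ (schemeLaw ρ L r C T N).real (⋃ a ∈ Finset.range (L + 1), ⋃ e ∈ exposedEnds L r S a,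
        {ω | ∃ i : Fin N, (i : ℕ) / 2 ^ (L - a - r) = e ∧
          BadChain ω.1 (observed ω.1 ω.2 S) S a i}) := by
        refine measureReal_mono ?_ (measure_ne_top _ _)
        rintro ω ⟨a, ha, i, hi, hb⟩
        exact Set.mem_biUnion (x := a) (Finset.mem_range.2 (by omega))
          (Set.mem_biUnion (x := (i : ℕ) / 2 ^ (L - a - r)) (mem_exposedEnds hr hi) ⟨i, rfl, hb⟩)
    _ ≤ ∑ a ∈ Finset.range (L + 1), ∑ e ∈ exposedEnds L r S a, β := by
        refine (measureReal_biUnion_finset_le _ _).trans (Finset.sum_le_sum fun a ha => ?_)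
        refine (measureReal_biUnion_finset_le _ _).trans (Finset.sum_le_sum fun e _ => ?_)
        exact hone a (by have := Finset.mem_range.1 ha; omega) e
    _ ≤ ∑ a ∈ Finset.range (L + 1), (K * 2 ^ (2 * r + 1)) * β := by
        refine Finset.sum_le_sum fun a ha => ?_
        rw [Finset.sum_const, nsmul_eq_mul]
        refine mul_le_mul_of_nonneg_right ?_ hβ
        exact_mod_cast card_exposedEnds_le hS hN (by have := Finset.mem_range.1 ha; omega)
    _ = _ := by
        rw [Finset.sum_const, nsmul_eq_mul, Finset.card_range]; push_cast; ring

end Chains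

/-! ### Decoding when no exposed chain is bad -/

section Decoding

variable {L r C T N : ℕ} {d : Design L r C T N} {y : TestIdx L r C T → Bool} {S : Finset (Fin N)}

open Classical in
theorem card_filter_wrongTest (R : Finset (Fin (L + r))) (i : Fin N) :
    ((R ×ˢ Finset.univ).filter fun q : Fin (L + r) × Fin C =>
      WrongTest d y S q.1 q.2 (nodeOf L q.1 i)).card =
    ∑ ℓ ∈ R, (Finset.univ.filter fun j : Fin C => WrongTest d y S ℓ j (nodeOf L ℓ i)).card := by
  simp only [Finset.card_filter, Finset.sum_product]

open Classical in
theorem WrongMajority.of_levels {R : Finset (Fin (L + r))} {i : Fin N}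
    (h : ∀ ℓ ∈ R, C ≤ 2 * (Finset.univ.filter fun j : Fin C =>
      WrongTest d y S ℓ j (nodeOf L ℓ i)).card) : WrongMajority d y S R i := by
  rw [WrongMajority, card_filter_wrongTest, Finset.mul_sum]
  simpa using Finset.sum_le_sum h

open Classical in
theorem card_wrongTest_of_not_meets {ℓ : Fin (L + r)} {u : Fin N} (hu : ¬ NodeMeets L ℓ S u) :
    (Finset.univ.filter fun j : Fin C => WrongTest d y S ℓ j u).card =
      (Finset.univ.filter fun j : Fin C => y (ℓ, j, d (ℓ, j, u)) = true).card := by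
  congr 1; ext j; simp [WrongTest, hu]

open Classical in
theorem card_wrongTest_of_meets {ℓ : Fin (L + r)} {u : Fin N} (hu : NodeMeets L ℓ S u) :
    (Finset.univ.filter fun j : Fin C => WrongTest d y S ℓ j u).card +
      (Finset.univ.filter fun j : Fin C => y (ℓ, j, d (ℓ, j, u)) = true).card = C := by
  rw [add_comm]
  convert Finset.card_filter_add_card_filter_not (s := (Finset.univ : Finset (Fin C)))
    (fun j : Fin C => y (ℓ, j, d (ℓ, j, u)) = true) using 4 with j
  · simp [WrongTest, hu]
  · simp

/-- On a chain that is not bad, and either lies in nodes with items of `S` or avoids these nodes,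
the density is on the right side of `1/2`. -/
theorem half_lt_density_iff (hr : 0 < r) {a : ℕ} (ha : a ≤ L) {i : Fin N} {P : Prop}
    (hP : ∀ ℓ ∈ window L r a r, (NodeMeets L ℓ S (nodeOf L ℓ i) ↔ P))
    (hb : ¬ BadChain d y S a i) : 1 / 2 < density d y a i ↔ P := by
  classical
  have hr' : (0 : ℝ) < r := by exact_mod_cast hr
  have hden : 1 / 2 < density d y a i ↔ r < 2 * chainMultiplicity d y a i := by
    rw [density, div_lt_div_iff₀ (by norm_num) hr', one_mul, mul_comm]
    exact_mod_cast Iff.rfl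
  have hmul : chainMultiplicity d y a i =
      ((window L r a r).filter fun ℓ => ClaimedDefective d y ℓ (nodeOf L ℓ i)).card := by
    rw [chainMultiplicity, window, Finset.filter_filter]
    congr 1; ext ℓ; simp [and_assoc]
  rw [hden, hmul]
  by_cases hPt : P
  · simp only [hPt, iff_true] at hP ⊢
    by_contra hc
    have hsum := Finset.card_filter_add_card_filter_not (s := window L r a r)
      (fun ℓ => ClaimedDefective d y ℓ (nodeOf L ℓ i))
    rw [card_window (by omega)] at hsum
    obtain ⟨R, hR, hRc⟩ := Finset.exists_subset_card_eq (s := (window L r a r).filter fun ℓ =>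
      ¬ ClaimedDefective d y ℓ (nodeOf L ℓ i)) (n := (r + 1) / 2) (by omega)
    refine hb ⟨R, fun ℓ hℓ => (Finset.mem_filter.1 (hR hℓ)).1, hRc,
      WrongMajority.of_levels fun ℓ hℓ => ?_⟩
    obtain ⟨h1, h2⟩ := Finset.mem_filter.1 (hR hℓ)
    have h3 := card_wrongTest_of_meets (d := d) (y := y) (hP ℓ h1)
    unfold ClaimedDefective at h2
    omega
  · simp only [hPt, iff_false] at hP ⊢
    intro hc
    obtain ⟨R, hR, hRc⟩ := Finset.exists_subset_card_eq (s := (window L r a r).filter fun ℓ =>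
      ClaimedDefective d y ℓ (nodeOf L ℓ i)) (n := (r + 1) / 2) (by omega)
    refine hb ⟨R, fun ℓ hℓ => (Finset.mem_filter.1 (hR hℓ)).1, hRc,
      WrongMajority.of_levels fun ℓ hℓ => ?_⟩
    obtain ⟨h1, h2⟩ := Finset.mem_filter.1 (hR hℓ)
    rw [card_wrongTest_of_not_meets (hP ℓ h1)]
    unfold ClaimedDefective at h2
    omega

/-- None of the exposed chains is bad. -/
def AllGood (d : Design L r C T N) (y : TestIdx L r C T → Bool) (S : Finset (Fin N)) : Prop :=
  ∀ a ≤ L, ∀ i, Exposed L r S a i → ¬ BadChain d y S a i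

theorem Exposed.of_mem {a : ℕ} {i : Fin N} (h : i ∈ S) : Exposed L r S a i :=
  Or.inr (NodeMeets.of_mem h)

theorem half_lt_density_of_mem (hr : 0 < r) (hG : AllGood d y S) {a : ℕ} (ha : a ≤ L) {i : Fin N}
    (hi : i ∈ S) : 1 / 2 < density d y a i :=
  (half_lt_density_iff (P := True) hr ha (fun ℓ _ => by simpa using NodeMeets.of_mem hi)
    (hG a ha i (.of_mem hi))).2 trivial

theorem nodeMeets_of_half_lt_density (hr : 0 < r) (hG : AllGood d y S) {a : ℕ} (ha : a ≤ L)
    {i : Fin N} (he : Exposed L r S a i) (h : 1 / 2 < density d y a i) :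
    NodeMeets L a S (nodeOf L a i) := by
  by_contra hc
  refine (half_lt_density_iff (P := False) hr ha (fun ℓ hℓ => ?_) (hG a ha i he)).1 h
  simp only [iff_false]
  exact fun hm => hc (hm.of_le (mem_window.1 hℓ).1)

theorem densityEstimate_eq (hr : 0 < r) (hG : AllGood d y S) : densityEstimate d y = S := by
  have hLr := Nat.div_mul_le_self L r
  have hpd : ∀ b ≤ L / r, ∀ i, PossiblyDefective d y b i →
      b = 0 ∨ NodeMeets L ((b - 1) * r) S (nodeOf L ((b - 1) * r) i) := by
    intro b
    induction b with
    | zero => intro _ i _; exact Or.inl rfl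
    | succ b ih =>
      intro hb i hi
      have hbr : (b + 1) * r ≤ L := (Nat.mul_le_mul_right r hb).trans hLr
      rw [add_mul, one_mul] at hbr
      refine Or.inr (nodeMeets_of_half_lt_density hr hG (by simp; omega) ?_ hi.2)
      have hw : branchStart L r (b * r) = b * r := by unfold branchStart; omega
      simp only [Exposed, Nat.add_sub_cancel, hw]
      rcases ih (by omega) i hi.1 with rfl | h
      · simp
      · exact Or.inr (h.of_le (by rw [Nat.sub_mul]; omega))
  ext i
  simp only [densityEstimate, Finset.mem_filter, Finset.mem_univ, true_and]
  constructor
  · rintro ⟨h1, h2⟩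
    refine (nodeMeets_leaf (L := L) (ℓ := L) (by omega)).1
      (nodeMeets_of_half_lt_density hr hG le_rfl ?_ h2)
    have hlt := Nat.lt_div_mul_add (a := L) hr
    have hw : branchStart L r L = L - r := by unfold branchStart; omega
    simp only [Exposed, hw]
    rcases hpd _ le_rfl i h1 with h | h
    · rw [h] at hlt
      exact Or.inl (by omega)
    · exact Or.inr (h.of_le (by rw [Nat.sub_mul]; omega))
  · intro hi
    refine ⟨?_, half_lt_density_of_mem hr hG le_rfl hi⟩
    have : ∀ b ≤ L / r, PossiblyDefective d y b i := by
      intro b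
      induction b with
      | zero => intro _; trivial
      | succ b ih =>
        intro hb
        have hbr : (b + 1) * r ≤ L := (Nat.mul_le_mul_right r hb).trans hLr
        rw [add_mul, one_mul] at hbr
        exact ⟨ih (by omega), half_lt_density_of_mem hr hG (by omega) hi⟩
    exact this _ le_rfl

/-! ### The lookahead test -/

theorem readResult_decoderInput {c ℓ j : ℕ} (hℓ : ℓ < L + r) (hj : j < C) (u : Fin N) :
    readResult (decoderInput c d y) ℓ j u =
      (y (⟨ℓ, hℓ⟩, ⟨j, hj⟩, d (⟨ℓ, hℓ⟩, ⟨j, hj⟩, u))).toNat := by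
  simp [readResult, decoderInput, hℓ, hj]

theorem positiveCount_decoderInput {c h a : ℕ} (ha : a + h ≤ L + r) (x : Fin N) :
    positiveCount (decoderInput c d y) L C h a x = ∑ ℓ ∈ window L r a h,
      (Finset.univ.filter fun j : Fin C => y (ℓ, j, d (ℓ, j, nodeOf L ℓ x)) = true).card := by
  have h1 : ∀ ℓ : Fin (L + r),
      (Finset.univ.filter fun j : Fin C => y (ℓ, j, d (ℓ, j, nodeOf L ℓ x)) = true).card =
      ∑ j ∈ Finset.range C, readResult (decoderInput c d y) ℓ j (x / 2 ^ (L - 1 - (ℓ : ℕ))) := by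
    intro ℓ
    rw [Finset.card_filter, Finset.sum_range]
    refine Finset.sum_congr rfl fun j _ => ?_
    have := readResult_decoderInput (c := c) (d := d) (y := y) ℓ.2 j.2 (nodeOf L ℓ x)
    simp only [nodeOf] at this ⊢
    rw [this]
    split_ifs with hy <;> simp_all
  simp only [h1]
  refine Eq.trans ?_ (Finset.sum_map (window L r a h) Fin.valEmbedding fun ℓ =>
    ∑ j ∈ Finset.range C, readResult (decoderInput c d y) ℓ j (x / 2 ^ (L - 1 - ℓ)))
  rw [map_window ha, Finset.sum_Ico_eq_sum_range, Nat.add_sub_cancel_left]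
  rfl

theorem chainPasses_iff {c a : ℕ} (ha : a ≤ L) {x : Fin N} {P : Prop}
    (hP : ∀ ℓ ∈ window L r a ((r + 1) / 2), (NodeMeets L ℓ S (nodeOf L ℓ x) ↔ P))
    (hb : ¬ BadChain d y S a x) :
    ChainPasses (decoderInput c d y) L C ((r + 1) / 2) a x ↔ P := by
  classical
  have hcard : (window L r a ((r + 1) / 2)).card = (r + 1) / 2 := card_window (by omega)
  have hw : ¬ WrongMajority d y S (window L r a ((r + 1) / 2)) x := by
    refine fun h => hb ⟨_, fun ℓ hℓ => ?_, hcard, h⟩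
    rw [mem_window] at hℓ ⊢
    omega
  rw [WrongMajority, card_filter_wrongTest, hcard] at hw
  rw [ChainPasses, positiveCount_decoderInput (by omega)]
  by_cases hPt : P
  · simp only [hPt, iff_true] at hP ⊢
    have hsum : ∑ ℓ ∈ window L r a ((r + 1) / 2),
        (Finset.univ.filter fun j : Fin C => WrongTest d y S ℓ j (nodeOf L ℓ x)).card +
        ∑ ℓ ∈ window L r a ((r + 1) / 2), (Finset.univ.filter fun j : Fin C =>
          y (ℓ, j, d (ℓ, j, nodeOf L ℓ x)) = true).card = (r + 1) / 2 * C := by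
      rw [← Finset.sum_add_distrib,
        Finset.sum_congr rfl fun ℓ hℓ => card_wrongTest_of_meets (hP ℓ hℓ)]
      simp [hcard]
    omega
  · simp only [hPt, iff_false] at hP ⊢
    rw [Finset.sum_congr rfl fun ℓ hℓ => card_wrongTest_of_not_meets (hP ℓ hℓ)] at hw
    omega

theorem blockMeets_iff {a : ℕ} {i : Fin N} :
    BlockMeets L (S.map Fin.valEmbedding) a i ↔ NodeMeets L a S (nodeOf L a i) := by
  simp [BlockMeets, NodeMeets, nodeOf_eq_iff]

theorem nodePasses_iff {c a : ℕ} (hr : 0 < r) (hG : AllGood d y S) (ha : a < L) {i : Fin N}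
    (hi : ∀ a' < a, NodeMeets L a' S (nodeOf L a' i)) :
    NodePasses (decoderInput c d y) N L C ((r + 1) / 2) a i ↔ NodeMeets L a S (nodeOf L a i) := by
  constructor
  · rintro ⟨x, hx, -, hxi, hpass⟩
    by_contra hc
    have hxi' : nodeOf L a (⟨x, hx⟩ : Fin N) = nodeOf L a i := nodeOf_eq_iff.2 hxi
    refine (chainPasses_iff (P := False) (x := ⟨x, hx⟩) ha.le (fun ℓ hℓ => ?_)
      (hG a ha.le _ ?_)).1 hpass
    · simp only [iff_false]
      intro hm
      have := hm.of_le (mem_window.1 hℓ).1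
      rw [hxi'] at this
      exact hc this
    · rcases Nat.eq_zero_or_pos (branchStart L r a - r) with h0 | hpos
      · exact Or.inl (by omega)
      · refine Or.inr ?_
        have hlt : branchStart L r a - r < a := by unfold branchStart at hpos ⊢; omega
        rw [nodeOf_eq_of_le hlt.le hxi']
        exact hi _ hlt
  · rintro ⟨s, hs, hsi⟩
    -- the first item with the same chain as `s`
    have hxs : (s : ℕ) / 2 ^ (L - a - (r + 1) / 2) * 2 ^ (L - a - (r + 1) / 2) ≤ s :=
      Nat.div_mul_le_self _ _
    set x : Fin N := ⟨(s : ℕ) / 2 ^ (L - a - (r + 1) / 2) * 2 ^ (L - a - (r + 1) / 2),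
      hxs.trans_lt s.2⟩ with hx
    have hdiv : (x : ℕ) / 2 ^ (L - a - (r + 1) / 2) = s / 2 ^ (L - a - (r + 1) / 2) := by
      rw [hx]; exact Nat.mul_div_cancel _ (by positivity)
    have hnode : ∀ ℓ, ℓ < a + (r + 1) / 2 → nodeOf L ℓ x = nodeOf L ℓ s := fun ℓ hℓ =>
      nodeOf_eq_iff.2 (div_two_pow_eq_of_le (by omega) hdiv)
    refine ⟨x, x.2, Dvd.intro_left _ rfl,
      nodeOf_eq_iff.1 ((hnode a (by omega)).trans hsi), ?_⟩
    have hbad : ¬ BadChain d y S a s := hG a ha.le s (.of_mem hs)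
    have hpos : positiveCount (decoderInput c d y) L C ((r + 1) / 2) a x =
        positiveCount (decoderInput c d y) L C ((r + 1) / 2) a s := by
      rw [positiveCount_decoderInput (by omega), positiveCount_decoderInput (by omega)]
      refine Finset.sum_congr rfl fun ℓ hℓ => ?_
      rw [hnode ℓ (mem_window.1 hℓ).2]
    rw [ChainPasses, hpos]
    exact (chainPasses_iff (P := True) ha.le (fun ℓ _ => by simpa using NodeMeets.of_mem hs)
      hbad).2 trivial

/-- A bound for the cost of the decoder, in terms of a bound `K` for the number of defective
items. -/
def decoderBound (L C h K : ℕ) : ℕ := decoderCost L C h (K + (4 * K + 1) + L * K * 2)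

theorem decodesWithin (hr : 0 < r) (hL : 0 < L) (hG : AllGood d y S) {c K : ℕ}
    (hS : S.card ≤ K) (hN : N < 2 ^ (L + 1) * K)
    (hT : T < 2 ^ (c * Nat.size N)) (hrW : r + 1 < 2 ^ (c * Nat.size N))
    (hW : 2 * N + 2 * 2 ^ L + 2 * ((r + 1) / 2 * C) + (r + 1) / 2 + L + C + 4 <
      2 ^ (c * Nat.size N)) {b : ℝ} (hb : (decoderBound L C ((r + 1) / 2) K : ℝ) ≤ b) :
    DecodesWithin decoderProg c K d y b S := by
  have hA : Adequate (decoderInput c d y) N L C ((r + 1) / 2) := by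
    refine ⟨fun ℓ j u => ?_, fun ℓ j u => ?_, hW⟩
    · simp only [decoderInput]
      split_ifs
      · exact (Fin.is_lt _).trans hT
      · positivity
    · simp only [readResult, decoderInput]
      split_ifs <;> first | exact Bool.toNat_le _ | exact zero_le_one
  obtain ⟨n, s, h1, h2, h3⟩ := decoderProg_spec (K := K) (T := T) (S := S.map Fin.valEmbedding)
    hA hr hL hrW (by simp) (fun i hi a ha hm => by
      rw [nodePasses_iff (i := ⟨i, hi⟩) hr hG ha (fun a' ha' => blockMeets_iff.1 (hm a' ha')),
        ← blockMeets_iff])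
  refine ⟨n, s, h1, le_trans ?_ hb, h3⟩
  have hcard : (jumpTargets N L (S.map Fin.valEmbedding)).card ≤ K + (4 * K + 1) + L * K * 2 := by
    refine (card_jumpTargets_le _ _ _).trans ?_
    rw [Finset.card_map]
    have hdiv : N / 2 ^ (L - 1) ≤ 4 * K := by
      refine Nat.div_le_of_le_mul (hN.le.trans (le_of_eq ?_))
      obtain ⟨m, rfl⟩ := Nat.exists_eq_succ_of_ne_zero hL.ne'
      simp [pow_succ]; ring
    have := Nat.mul_le_mul_left L hS
    omega
  have : n ≤ decoderBound L C ((r + 1) / 2) K := by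
    refine h2.trans ?_
    unfold decoderBound decoderCost
    exact Nat.add_le_add_right (Nat.mul_le_mul_right _ hcard) _
  exact_mod_cast this

end Decoding

/-! ### Asymptotics -/

/-- The logarithm of `N` is dominated by every power of `K`, and `K` by `N`. -/
theorem eventually_growth {α c₁ c₂ : ℝ} (hα₀ : 0 < α) (hα₁ : α < 1) (hc₁ : 0 < c₁) (M : ℝ) {δ : ℝ}
    (hδ : 0 < δ) : ∃ N₀ : ℕ, ∀ N K : ℕ, N₀ ≤ N → c₁ * (N : ℝ) ^ α ≤ (K : ℝ) →
      (K : ℝ) ≤ c₂ * (N : ℝ) ^ α → M ≤ K ∧ 2 * (K : ℝ) ≤ N ∧ M * (logb 2 N + 1) ≤ (K : ℝ) ^ δ := by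
  have h1 : ∀ᶠ x : ℝ in Filter.atTop, M / c₁ ≤ x ^ α :=
    (tendsto_rpow_atTop hα₀).eventually_ge_atTop _
  have h2 : ∀ᶠ x : ℝ in Filter.atTop, 2 * c₂ ≤ x ^ (1 - α) :=
    (tendsto_rpow_atTop (by linarith)).eventually_ge_atTop _
  have h3 : ∀ᶠ x : ℝ in Filter.atTop, M * (logb 2 x + 1) ≤ c₁ ^ δ * x ^ (α * δ) := by
    have hlog : (fun x : ℝ => M * (logb 2 x + 1)) =o[Filter.atTop] fun x : ℝ => x ^ (α * δ) := by
      refine Asymptotics.IsLittleO.const_mul_left (Asymptotics.IsLittleO.add ?_ ?_) M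
      · have := (isLittleO_log_rpow_atTop (mul_pos hα₀ hδ)).const_mul_left (log 2)⁻¹
        refine this.congr_left fun x => ?_
        rw [logb]; field_simp
      · exact Asymptotics.isLittleO_const_left.2 (Or.inr
          (Filter.tendsto_abs_atTop_atTop.comp (tendsto_rpow_atTop (mul_pos hα₀ hδ))))
    filter_upwards [hlog.bound (show 0 < c₁ ^ δ by positivity), Filter.eventually_ge_atTop 0]
      with x hx hx0
    rw [Real.norm_of_nonneg (Real.rpow_nonneg hx0 _)] at hx
    exact (le_abs_self _).trans hx
  obtain ⟨N₀, hN₀⟩ := Filter.eventually_atTop.1 (tendsto_natCast_atTop_atTop.eventually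
    (h1.and (h2.and (h3.and (Filter.eventually_gt_atTop (0 : ℝ))))))
  refine ⟨N₀, fun N K hN hK₁ hK₂ => ?_⟩
  obtain ⟨g1, g2, g3, g0⟩ := hN₀ N hN
  refine ⟨?_, ?_, g3.trans ?_⟩
  · rw [div_le_iff₀ hc₁, mul_comm] at g1
    exact g1.trans hK₁
  · have h : (N : ℝ) ^ α * (N : ℝ) ^ (1 - α) = N := by
      rw [← Real.rpow_add g0]; simp
    have h4 : 0 ≤ (N : ℝ) ^ α := by positivity
    nlinarith [mul_le_mul_of_nonneg_left g2 h4]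
  · rw [Real.rpow_mul g0.le, ← Real.mul_rpow hc₁.le (by positivity)]
    exact Real.rpow_le_rpow (by positivity) hK₁ hδ.le

/-- The cost of the decoder, with one quantity `Y` for everything that is at most logarithmic. -/
theorem decoderBound_le {L C h K : ℕ} {Y P : ℝ} (hL : (L : ℝ) + 1 ≤ Y) (hh : (h : ℝ) + 1 ≤ Y)
    (hC : (C : ℝ) + 1 ≤ Y) (hY : 100 ≤ Y) (hK : 1 ≤ K) (hP : (2 : ℝ) ^ h ≤ Y * P) :
    (decoderBound L C h K : ℝ) ≤ K * P * Y ^ 9 := by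
  have hY0 : 0 ≤ Y := by linarith
  have hK' : (1 : ℝ) ≤ K := by exact_mod_cast hK
  have hQ1 : (1 : ℝ) ≤ 2 ^ h := one_le_pow₀ (by norm_num)
  set Q : ℝ := 2 ^ h
  have hL0 : (0 : ℝ) ≤ L := by positivity
  have hC0 : (0 : ℝ) ≤ C := by positivity
  have hh0 : (0 : ℝ) ≤ h := by positivity
  have hpow : ∀ n : ℕ, 100 * Y ^ n ≤ Y ^ (n + 1) := fun n => by
    rw [pow_succ, mul_comm]; exact mul_le_mul_of_nonneg_left hY (by positivity)
  have hY2 : Y ≤ Y ^ 2 := le_self_pow₀ (by linarith) (by norm_num)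
  have e1 : (nodeTestCost L C h : ℝ) ≤ Q * Y ^ 3 := by
    have h1 : (h : ℝ) * (11 * L + 20 * C + 30) ≤ Y * (32 * Y) :=
      mul_le_mul (by linarith) (by linarith) (by positivity) hY0
    have h2 : (h : ℝ) * (11 * L + 20 * C + 30) + 40 ≤ 33 * Y ^ 2 := by nlinarith
    calc (nodeTestCost L C h : ℝ) = Q * (h * (11 * L + 20 * C + 30) + 40) + (22 * L + 60) := by
          simp only [nodeTestCost, Q]; push_cast; ring
      _ ≤ Q * (33 * Y ^ 2) + Q * (23 * Y ^ 2) := by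
          refine add_le_add (mul_le_mul_of_nonneg_left h2 (by positivity)) ?_
          have h3 : 22 * (L : ℝ) + 60 ≤ 23 * Y ^ 2 := by linarith
          nlinarith [sq_nonneg Y]
      _ = Q * (56 * Y ^ 2) := by ring
      _ ≤ Q * Y ^ 3 := by
          refine mul_le_mul_of_nonneg_left ?_ (by positivity)
          have := hpow 2
          nlinarith [sq_nonneg Y]
  have hQY : (100 : ℝ) ≤ Q * Y ^ 3 := by
    have h1 : (1 : ℝ) ≤ Y ^ 2 := one_le_pow₀ (by linarith)
    have h2 : 100 ≤ Y ^ 3 := by have := hpow 2; simp only [Nat.reduceAdd] at this; linarith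
    nlinarith
  have e2 : (descendCost L C h : ℝ) + 20 ≤ Q * Y ^ 5 := by
    calc (descendCost L C h : ℝ) + 20 = (L + 1) * (nodeTestCost L C h + 12) + 30 := by
          simp only [descendCost]; push_cast; ring
      _ ≤ Y * (Q * Y ^ 3 + Q * Y ^ 3) + Y * (Q * Y ^ 3) := by
          refine add_le_add (mul_le_mul hL (by linarith) (by positivity) hY0) ?_
          nlinarith
      _ = Q * (3 * Y ^ 4) := by ring
      _ ≤ Q * Y ^ 5 := by
          refine mul_le_mul_of_nonneg_left ?_ (by positivity)
          have := hpow 4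
          nlinarith [pow_nonneg hY0 4]
  have e3 : (K : ℝ) + (4 * K + 1) + L * K * 2 ≤ K * Y ^ 2 := by
    have h1 : 6 + 2 * (L : ℝ) ≤ Y ^ 2 := by
      have := hpow 1
      simp only [pow_one, Nat.reduceAdd] at this
      linarith
    have := mul_le_mul_of_nonneg_left h1 (show (0 : ℝ) ≤ K by positivity)
    linarith
  have hP0 : 0 ≤ P := by
    by_contra hc
    nlinarith
  calc (decoderBound L C h K : ℝ)
      = (K + (4 * K + 1) + L * K * 2) * (descendCost L C h + 20) + 20 := by
        simp only [decoderBound, decoderCost]; push_cast; ring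
    _ ≤ K * Y ^ 2 * (Q * Y ^ 5) + K * Y ^ 2 * (Q * Y ^ 5) := by
        refine add_le_add (mul_le_mul e3 e2 (by positivity) (by positivity)) ?_
        have h1 : 100 ≤ Q * Y ^ 5 := by
          refine hQY.trans (mul_le_mul_of_nonneg_left ?_ (by positivity))
          exact pow_le_pow_right₀ (by linarith) (by norm_num)
        have h2 : 1 ≤ K * Y ^ 2 := by nlinarith
        nlinarith
    _ = K * Q * (2 * Y ^ 7) := by ring
    _ ≤ K * (Y * P) * Y ^ 8 := by
        refine mul_le_mul (mul_le_mul_of_nonneg_left hP (by positivity)) ?_ (by positivity)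
          (by positivity)
        have := hpow 7
        nlinarith [pow_nonneg hY0 7]
    _ = K * P * Y ^ 9 := by ring

theorem logb_two_exp_ge : (21 / 10 : ℝ) ≤ logb 2 (2 * exp 1) := by
  have h1 : (21 : ℝ) ≤ logb 2 ((2 * exp 1) ^ 10) := by
    rw [Real.le_logb_iff_rpow_le (by norm_num) (by positivity)]
    have h2 : (5.4 : ℝ) ^ 10 ≤ (2 * exp 1) ^ 10 :=
      pow_le_pow_left₀ (by norm_num) (by have := Real.exp_one_gt_d9; linarith) _
    refine le_trans ?_ h2
    norm_num
  rw [Real.logb_pow] at h1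
  push_cast at h1
  linarith

/-- The union bound in terms of `K`: the powers of two are powers of `K`, and the base `2 * exp 1`
of the exponent leaves room for the number of levels. -/
theorem failure_le {ε q Y : ℝ} {C L K r : ℕ} (hε : 0 < ε) (hC : 0 < C) (hq : 0 < q)
    (hq1 : 2 * exp 1 * q < 1) (hK : 1 ≤ K) (hr : (r : ℝ) ≤ ε * logb 2 K)
    (hr' : ε * logb 2 K < r + 1) (hY : Y = (K : ℝ) ^ (ε / 20)) (hL : 2 * ((L : ℝ) + 1) ≤ Y) :
    (L + 1) * (K * 2 ^ (2 * r + 1)) * (2 ^ r * (2 * √(2 * exp 1 * q / 4)) ^ ((r + 1) / 2 * C)) ≤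
      (√(2 * exp 1 * q)) ^ (-(C / 2 : ℝ)) * (K : ℝ) ^
        (ε * C / 4 * (logb 2 q + logb 2 (2 * exp 1) * ((C + 2) / C)) + 1 + 2 * ε) := by
  have hK0 : (0 : ℝ) < K := by exact_mod_cast hK
  have hK1 : (1 : ℝ) ≤ K := by exact_mod_cast hK
  have hC0 : (0 : ℝ) < C := by exact_mod_cast hC
  have hz0 : 0 < 2 * exp 1 * q := by positivity
  set y := √(2 * exp 1 * q) with hy
  have hy0 : 0 < y := Real.sqrt_pos.2 hz0
  have hy1 : y ≤ 1 := Real.sqrt_le_one.2 hq1.le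
  have h2y : 2 * √(2 * exp 1 * q / 4) = y := by
    rw [Real.sqrt_div hz0.le, show (4 : ℝ) = 2 ^ 2 by norm_num, Real.sqrt_sq (by norm_num)]
    ring
  have hlog2 : 0 < log 2 := Real.log_pos (by norm_num)
  have h2r : (2 : ℝ) ^ r ≤ (K : ℝ) ^ ε := by
    rw [← Real.rpow_natCast]
    calc (2 : ℝ) ^ (r : ℝ) ≤ 2 ^ (ε * logb 2 K) := Real.rpow_le_rpow_of_exponent_le (by norm_num) hr
      _ = (K : ℝ) ^ ε := by
          rw [mul_comm, Real.rpow_mul (by norm_num), Real.rpow_logb (by norm_num) (by norm_num) hK0]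
  have hyr : y ^ ((r + 1) / 2 * C) ≤ y ^ (-(C / 2 : ℝ)) * (K : ℝ) ^ (ε * C / 2 * logb 2 y) := by
    rw [← Real.rpow_natCast]
    have hexp : -(C / 2 : ℝ) + ε * logb 2 K * (C / 2) ≤ (((r + 1) / 2 * C : ℕ) : ℝ) := by
      have h1 : (r : ℝ) ≤ 2 * (((r + 1) / 2 : ℕ) : ℝ) := by
        have : r ≤ 2 * ((r + 1) / 2) := by omega
        exact_mod_cast this
      push_cast
      nlinarith
    refine (Real.rpow_le_rpow_of_exponent_ge hy0 hy1 hexp).trans (le_of_eq ?_)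
    rw [Real.rpow_add hy0]
    congr 1
    rw [Real.rpow_def_of_pos hy0, Real.rpow_def_of_pos hK0, logb, logb]
    congr 1
    field_simp
  have hν : ε * C / 4 * (logb 2 q + logb 2 (2 * exp 1) * ((C + 2) / C)) + 1 + 2 * ε =
      1 + ε * 3 + ε * C / 2 * logb 2 y + ε * (logb 2 (2 * exp 1) / 2 - 1) := by
    have : logb 2 y = (logb 2 (2 * exp 1) + logb 2 q) / 2 := by
      rw [hy, Real.sqrt_eq_rpow, Real.logb_rpow_eq_mul_logb_of_pos hz0,
        Real.logb_mul (by positivity) hq.ne']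
      ring
    rw [this]
    field_simp
    ring
  have hYle : Y ≤ (K : ℝ) ^ (ε * (logb 2 (2 * exp 1) / 2 - 1)) := by
    rw [hY]
    refine Real.rpow_le_rpow_of_exponent_le hK1 ?_
    have := logb_two_exp_ge
    nlinarith
  rw [h2y, hν, Real.rpow_add hK0, Real.rpow_add hK0, Real.rpow_add hK0, Real.rpow_one,
    Real.rpow_mul hK0.le]
  have h3 : ((K : ℝ) ^ ε) ^ (3 : ℝ) = ((K : ℝ) ^ ε) ^ 3 := by exact_mod_cast Real.rpow_natCast _ 3
  rw [h3]
  calc ((L : ℝ) + 1) * (K * 2 ^ (2 * r + 1)) * (2 ^ r * y ^ ((r + 1) / 2 * C))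
      = K * ((2 ^ r) ^ 3) * y ^ ((r + 1) / 2 * C) * (2 * (L + 1)) := by ring
    _ ≤ K * ((K : ℝ) ^ ε) ^ 3 * (y ^ (-(C / 2 : ℝ)) * (K : ℝ) ^ (ε * C / 2 * logb 2 y)) *
        (K : ℝ) ^ (ε * (logb 2 (2 * exp 1) / 2 - 1)) := by
        have := hL.trans hYle
        gcongr
    _ = _ := by ring

theorem decoderBound_le_rpow {ε Y : ℝ} {L r C K : ℕ} (hε : 0 < ε) (hK : (100 : ℝ) ≤ K)
    (hr : (r : ℝ) ≤ ε * logb 2 K) (hY : Y = (K : ℝ) ^ (ε / 20)) (hL : (L : ℝ) + 1 ≤ Y)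
    (hh : (((r + 1) / 2 : ℕ) : ℝ) + 1 ≤ Y) (hC : (C : ℝ) + 1 ≤ Y) (h100 : 100 ≤ Y)
    (hεY : ε ^ 2 ≤ Y) :
    (decoderBound L C ((r + 1) / 2) K : ℝ) ≤ ε⁻¹ ^ 2 * (K : ℝ) ^ (1 + ε) := by
  have hK0 : (0 : ℝ) < K := by linarith
  have h2h : (2 : ℝ) ^ ((r + 1) / 2) ≤ Y * (K : ℝ) ^ (ε / 2) := by
    calc (2 : ℝ) ^ ((r + 1) / 2) = 2 ^ ((((r + 1) / 2 : ℕ)) : ℝ) := (Real.rpow_natCast _ _).symm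
      _ ≤ 2 ^ (1 + ε / 2 * logb 2 K) := by
          refine Real.rpow_le_rpow_of_exponent_le (by norm_num) ?_
          have : 2 * (((r + 1) / 2 : ℕ) : ℝ) ≤ r + 1 := by
            exact_mod_cast (by omega : 2 * ((r + 1) / 2) ≤ r + 1)
          linarith
      _ = 2 * (K : ℝ) ^ (ε / 2) := by
          rw [Real.rpow_add (by norm_num), Real.rpow_one, mul_comm (ε / 2),
            Real.rpow_mul (by norm_num), Real.rpow_logb (by norm_num) (by norm_num) hK0]
      _ ≤ _ := mul_le_mul_of_nonneg_right (by linarith) (by positivity)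
  refine (decoderBound_le hL hh hC h100
    (by exact_mod_cast (by linarith : (1 : ℝ) ≤ K)) h2h).trans ?_
  have hK2 : (K : ℝ) ^ (1 + ε) = K * (K : ℝ) ^ (ε / 2) * Y ^ 10 := by
    rw [hY, ← Real.rpow_natCast, ← Real.rpow_mul hK0.le,
      show 1 + ε = 1 + ε / 2 + ε / 20 * ((10 : ℕ) : ℝ) by push_cast; ring,
      Real.rpow_add hK0, Real.rpow_add hK0, Real.rpow_one]
  have hone : 1 ≤ ε⁻¹ ^ 2 * Y := by
    rw [inv_pow, ← div_eq_inv_mul, le_div_iff₀ (by positivity), one_mul]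
    exact hεY
  have hY0 : 0 ≤ Y := by linarith
  calc (K : ℝ) * (K : ℝ) ^ (ε / 2) * Y ^ 9
      ≤ K * (K : ℝ) ^ (ε / 2) * Y ^ 9 * (ε⁻¹ ^ 2 * Y) :=
        le_mul_of_one_le_right (by positivity) hone
    _ = _ := by rw [hK2]; ring

/-- Words of five times the length of `N` hold all the numbers that the decoder computes with. -/
theorem word_bounds {N L r C T : ℕ} (hN : 100 ≤ N) (hT : T ≤ N ^ 2) (hr : r ≤ N ^ 2) (hC : C ≤ N)
    (hL : 2 ^ L ≤ N) :
    T < 2 ^ (5 * Nat.size N) ∧ r + 1 < 2 ^ (5 * Nat.size N) ∧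
      2 * N + 2 * 2 ^ L + 2 * ((r + 1) / 2 * C) + (r + 1) / 2 + L + C + 4 <
        2 ^ (5 * Nat.size N) := by
  have hW : N ^ 5 < 2 ^ (5 * Nat.size N) := by
    rw [mul_comm, pow_mul]
    exact Nat.pow_lt_pow_left (Nat.lt_size_self N) (by norm_num)
  have hLN : L ≤ N := (Nat.lt_two_pow_self (n := L)).le.trans hL
  have h1 : N ≤ N ^ 2 := Nat.le_self_pow (by norm_num) N
  have h4 : (r + 1) / 2 ≤ N ^ 2 := by omega
  have hhC : (r + 1) / 2 * C ≤ N ^ 2 * N := Nat.mul_le_mul h4 hC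
  have h2 : 100 * N ^ 2 ≤ N ^ 2 * N := by rw [mul_comm]; exact Nat.mul_le_mul_left _ hN
  have h3 : 100 * (N ^ 2 * N) ≤ N ^ 5 := by
    calc 100 * (N ^ 2 * N) ≤ N ^ 2 * (N ^ 2 * N) := Nat.mul_le_mul_right _ (hN.trans h1)
      _ = N ^ 5 := by ring
  generalize 2 ^ (5 * Nat.size N) = W at *
  generalize 2 ^ L = V at *
  generalize N ^ 5 = N5 at *
  generalize N ^ 2 * N = N3 at *
  generalize N ^ 2 = N2 at *
  generalize (r + 1) / 2 * C = H at *
  exact ⟨by omega, by omega, by omega⟩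

/-- What holds for all large `N`: bounds for the rounded parameters, for the probability that a test
misleads, for the number of levels, for the cost of the decoder, and for the numbers in words. -/
theorem eventually_parameters {ρ ζ α ε c₁ c₂ : ℝ} {C : ℕ} (hρ : 0 ≤ ρ) (hζ : 0 < ζ) (hα₀ : 0 < α)
    (hα₁ : α < 1) (hc₁ : 0 < c₁) (hε : 0 < ε) :
    ∃ N₀ : ℕ, ∀ N K : ℕ, N₀ ≤ N → c₁ * (N : ℝ) ^ α ≤ (K : ℝ) → (K : ℝ) ≤ c₂ * (N : ℝ) ^ α →
      ∀ L r T : ℕ, L = ⌊logb 2 ((N : ℝ) / K)⌋₊ → r = ⌊ε * logb 2 (K : ℝ)⌋₊ → T = ⌊ζ * (K : ℝ)⌋₊ →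
      1 ≤ K ∧ K ≤ N ∧ 0 < T ∧ 0 < r ∧ 0 < L ∧ N < 2 ^ (L + 1) * K ∧
      (L : ℝ) ≤ logb 2 ((N : ℝ) / K) ∧ (r : ℝ) ≤ ε * logb 2 K ∧ ε * logb 2 K < r + 1 ∧
      (T : ℝ) ≤ ζ * K ∧ ρ + K / T ≤ 2 * exp 1 * (ρ + 1 / ζ) / 4 ∧
      2 * ((L : ℝ) + 1) ≤ (K : ℝ) ^ (ε / 20) ∧
      (decoderBound L C ((r + 1) / 2) K : ℝ) ≤ ε⁻¹ ^ 2 * (K : ℝ) ^ (1 + ε) ∧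
      T < 2 ^ (5 * Nat.size N) ∧ r + 1 < 2 ^ (5 * Nat.size N) ∧
      2 * N + 2 * 2 ^ L + 2 * ((r + 1) / 2 * C) + (r + 1) / 2 + L + C + 4 <
        2 ^ (5 * Nat.size N) := by
  set M : ℝ := 100 + ζ + 4 / ζ + ε + ε ^ 2 + 2 ^ (1 / ε) + C with hM
  have hM1 : 100 ≤ M ∧ ζ ≤ M ∧ 4 / ζ ≤ M ∧ ε + 1 ≤ M ∧ ε ^ 2 ≤ M ∧ 2 ^ (1 / ε) ≤ M ∧
      (C : ℝ) + 1 ≤ M := by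
    have h1 : 0 < 4 / ζ := by positivity
    have h2 : (0 : ℝ) < 2 ^ (1 / ε) := by positivity
    have h3 : (0 : ℝ) ≤ C := by positivity
    have h4 : 0 < ε ^ 2 := by positivity
    refine ⟨?_, ?_, ?_, ?_, ?_, ?_, ?_⟩ <;> rw [hM] <;> linarith
  obtain ⟨m100, mζ, mζ', mε, mε2, m2ε, mC⟩ := hM1
  clear_value M
  obtain ⟨N₀, hN₀⟩ := eventually_growth (c₂ := c₂) hα₀ hα₁ hc₁ M (show 0 < ε / 20 by positivity)
  refine ⟨N₀, fun N K hN hK₁ hK₂ L r T hL hr hT => ?_⟩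
  obtain ⟨gK, gN, gY⟩ := hN₀ N K hN hK₁ hK₂
  have hK100 : (100 : ℝ) ≤ K := m100.trans gK
  have hK0 : (0 : ℝ) < K := by linarith
  have hN0 : (0 : ℝ) < N := by linarith
  have hNK : 2 ≤ (N : ℝ) / K := by rw [le_div_iff₀ hK0]; exact gN
  have hlogK : 0 ≤ logb 2 (K : ℝ) := Real.logb_nonneg (by norm_num) (by linarith)
  have hlogNK : 1 ≤ logb 2 ((N : ℝ) / K) := by
    rw [Real.le_logb_iff_rpow_le (by norm_num) (by positivity)]; simpa using hNK
  have hLle : (L : ℝ) ≤ logb 2 ((N : ℝ) / K) := hL ▸ Nat.floor_le (by linarith)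
  have hLlt : logb 2 ((N : ℝ) / K) < L + 1 := hL ▸ Nat.lt_floor_add_one _
  have hrle : (r : ℝ) ≤ ε * logb 2 K := hr ▸ Nat.floor_le (by positivity)
  have hrlt : ε * logb 2 K < r + 1 := hr ▸ Nat.lt_floor_add_one _
  have hTle : (T : ℝ) ≤ ζ * K := hT ▸ Nat.floor_le (by positivity)
  have hTlt : ζ * K < T + 1 := hT ▸ Nat.lt_floor_add_one _
  have hlogNKN : logb 2 ((N : ℝ) / K) ≤ logb 2 N :=
    Real.logb_le_logb_of_le (by norm_num) (by positivity) (div_le_self hN0.le (by linarith))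
  have hlogKN : logb 2 (K : ℝ) ≤ logb 2 N :=
    Real.logb_le_logb_of_le (by norm_num) hK0 (by linarith)
  have hlogKK : logb 2 (K : ℝ) ≤ K := by
    rw [Real.logb_le_iff_le_rpow (by norm_num) hK0, Real.rpow_natCast]
    exact_mod_cast (Nat.lt_two_pow_self (n := K)).le
  have hLpos : 0 < L := by
    rw [hL]; exact Nat.floor_pos.2 hlogNK
  have hζK : 4 ≤ ζ * K := by
    have := mζ'.trans gK
    rw [div_le_iff₀ hζ] at this
    linarith
  have hrpos : 0 < r := by
    rw [hr]; refine Nat.floor_pos.2 ?_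
    have h1 : 1 / ε ≤ logb 2 K := by
      rw [Real.le_logb_iff_rpow_le (by norm_num) hK0]; exact m2ε.trans gK
    rwa [div_le_iff₀ hε, mul_comm] at h1
  have hTpos : 0 < T := by
    have : (0 : ℝ) < T := by linarith
    exact_mod_cast this
  have hKN : K ≤ N := by
    have : (K : ℝ) ≤ N := by linarith
    exact_mod_cast this
  have h2L : (2 : ℝ) ^ L ≤ N := by
    rw [← Real.rpow_natCast, ← Real.le_logb_iff_rpow_le (by norm_num) hN0]
    exact hLle.trans hlogNKN
  have hNlt : N < 2 ^ (L + 1) * K := by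
    rw [Real.logb_lt_iff_lt_rpow (by norm_num) (by positivity), div_lt_iff₀ hK0] at hLlt
    have : (N : ℝ) < ((2 ^ (L + 1) * K : ℕ) : ℝ) := by
      push_cast
      exact_mod_cast hLlt
    exact_mod_cast this
  set Y : ℝ := (K : ℝ) ^ (ε / 20) with hY
  have hlogN : 0 ≤ logb 2 (N : ℝ) := hlogK.trans hlogKN
  have hMY : M ≤ Y := (le_mul_of_one_le_right (by linarith) (by linarith)).trans gY
  have hLY : 2 * ((L : ℝ) + 1) ≤ Y := by
    refine le_trans ?_ gY
    exact mul_le_mul (by linarith) (by linarith) (by positivity) (by linarith)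
  have hhr : (((r + 1) / 2 : ℕ) : ℝ) ≤ r := by exact_mod_cast (by omega : (r + 1) / 2 ≤ r)
  have hhY : (((r + 1) / 2 : ℕ) : ℝ) + 1 ≤ Y := by
    refine le_trans ?_ gY
    calc (((r + 1) / 2 : ℕ) : ℝ) + 1 ≤ ε * logb 2 N + 1 := by
          linarith [mul_le_mul_of_nonneg_left hlogKN hε.le]
      _ ≤ (ε + 1) * (logb 2 N + 1) := by
          linarith [mul_add ε (logb 2 N) 1, add_mul ε 1 (logb 2 N + 1)]
      _ ≤ M * (logb 2 N + 1) := mul_le_mul_of_nonneg_right mε (by linarith)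
  refine ⟨by exact_mod_cast (by linarith : (1 : ℝ) ≤ K), hKN, hTpos, hrpos, hLpos, hNlt, hLle, hrle,
    hrlt, hTle, ?_, hLY, ?_, ?_⟩
  · -- `exp 1 / 2 > 4 / 3` absorbs the rounding in `T`
    have he := Real.exp_one_gt_d9
    have hT3 : 3 / 4 * (ζ * K) ≤ T := by linarith
    have h1 : (K : ℝ) / T ≤ 4 / 3 * (1 / ζ) := by
      rw [div_le_iff₀ (by exact_mod_cast hTpos)]
      calc (K : ℝ) = 4 / 3 * (1 / ζ) * (3 / 4 * (ζ * K)) := by field_simp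
        _ ≤ _ := mul_le_mul_of_nonneg_left hT3 (by positivity)
    have h2 : 4 / 3 * (ρ + 1 / ζ) ≤ exp 1 / 2 * (ρ + 1 / ζ) :=
      mul_le_mul_of_nonneg_right (by linarith) (by positivity)
    calc ρ + K / T ≤ 4 / 3 * (ρ + 1 / ζ) := by rw [mul_add]; exact add_le_add (by linarith) h1
      _ ≤ _ := h2.trans (le_of_eq (by ring))
  · have : (0 : ℝ) ≤ L := by positivity
    exact decoderBound_le_rpow hε hK100 hrle hY (by linarith) hhY (mC.trans hMY)
      (m100.trans hMY) (mε2.trans hMY)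
  · have hN100 : 100 ≤ N := by
      exact_mod_cast (by linarith : (100 : ℝ) ≤ N)
    have hTN : T ≤ N ^ 2 := by
      have : (T : ℝ) ≤ (N : ℝ) ^ 2 := by
        have : ζ * K ≤ N * N := mul_le_mul (by linarith) (by linarith) hK0.le hN0.le
        linarith [sq (N : ℝ)]
      exact_mod_cast this
    have hrN : r ≤ N ^ 2 := by
      have : (r : ℝ) ≤ (N : ℝ) ^ 2 := by
        have : ε * logb 2 K ≤ N * N := mul_le_mul (by linarith) (by linarith) hlogK hN0.le
        linarith [sq (N : ℝ)]
      exact_mod_cast this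
    have hCN : C ≤ N := by
      exact_mod_cast (by linarith : (C : ℝ) ≤ N)
    exact word_bounds hN100 hTN hrN hCN (by exact_mod_cast h2L)

theorem mainTheorem2 (ρ ζ α c₁ c₂ B : ℝ) (hρ : 0 ≤ ρ) (hζ : 0 < ζ) (hα₀ : 0 < α) (hα₁ : α < 1)
    (hc₁ : 0 < c₁) (hρζ : 2 * Real.exp 1 * (ρ + 1 / ζ) < 1) :
    ∃ D : ℝ, 0 < D ∧ ∀ (ε : ℝ) (C' : ℕ), 0 < ε → 0 < C' → (C' : ℝ) ≤ B / ε →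
      ε * C' / 4 * (Real.logb 2 (ρ + 1 / ζ) + Real.logb 2 (2 * Real.exp 1) * ((C' + 2) / C'))
        < -(1 + 2 * ε) →
      ∃ (decoder : Prog) (c : ℕ) (E : ℝ) (N₀ : ℕ), ∀ N K : ℕ, N₀ ≤ N →
        c₁ * (N : ℝ) ^ α ≤ (K : ℝ) → (K : ℝ) ≤ c₂ * (N : ℝ) ^ α →
        ∀ L r T : ℕ, L = ⌊Real.logb 2 ((N : ℝ) / K)⌋₊ → r = ⌊ε * Real.logb 2 (K : ℝ)⌋₊ →
          T = ⌊ζ * (K : ℝ)⌋₊ →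
          Fintype.card (TestIdx L r C' T) = T * C' * (L + r) ∧
          (Fintype.card (TestIdx L r C' T) : ℝ) ≤
            ζ * C' * K * (Real.logb 2 ((N : ℝ) / K) + ε * Real.logb 2 (K : ℝ)) ∧
          ζ * C' * K * (Real.logb 2 ((N : ℝ) / K) + ε * Real.logb 2 (K : ℝ)) ≤
            D * ε⁻¹ * K * Real.log N ∧
          ∀ S : Finset (Fin N), S.card ≤ K →
            (schemeLaw ρ L r C' T N).real
              {ω | ¬ (densityEstimate ω.1 (observed ω.1 ω.2 S) = S ∧
                DecodesWithin decoder c K ω.1 (observed ω.1 ω.2 S)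
                  (D * ε⁻¹ ^ 2 * (K : ℝ) ^ (1 + ε)) S)} ≤
              E * (K : ℝ) ^
                (ε * C' / 4 *
                  (Real.logb 2 (ρ + 1 / ζ) + Real.logb 2 (2 * Real.exp 1) * ((C' + 2) / C'))
                  + 1 + 2 * ε) := by
  have hq : 0 < ρ + 1 / ζ := by positivity
  have hlog2 : 0 < log 2 := Real.log_pos (by norm_num)
  -- `ε ≤ B` because `C' ≥ 1`; so the number of levels is at most `(1 + B) * logb 2 N` for all `ε`
  refine ⟨ζ * |B| * (1 + |B|) / log 2 + 1, by positivity, fun ε C hε hC hCB _ => ?_⟩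
  set D := ζ * |B| * (1 + |B|) / log 2 + 1 with hD
  have hD1 : 1 ≤ D := le_add_of_nonneg_left (by positivity)
  have hC1 : (1 : ℝ) ≤ C := by exact_mod_cast hC
  have hεB : ε ≤ |B| := by
    have := hC1.trans hCB
    rw [le_div_iff₀ hε, one_mul] at this
    exact this.trans (le_abs_self B)
  have hCB' : (C : ℝ) ≤ |B| * ε⁻¹ := by
    rw [← div_eq_mul_inv]
    exact hCB.trans (div_le_div_of_nonneg_right (le_abs_self B) hε.le)
  obtain ⟨N₀, hN₀⟩ := eventually_parameters (C := C) (c₂ := c₂) hρ hζ hα₀ hα₁ hc₁ hε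
  refine ⟨decoderProg, 5, √(2 * exp 1 * (ρ + 1 / ζ)) ^ (-(C / 2 : ℝ)), N₀,
    fun N K hN hK₁ hK₂ L r T hL hr hT => ?_⟩
  obtain ⟨hK1, hKN, hTpos, hrpos, hLpos, hNlt, hLle, hrle, hrlt, hTle, hp, hLY, htime, hTW,
    hrW, hW⟩ :=
    hN₀ N K hN hK₁ hK₂ L r T hL hr hT
  have hK1' : (1 : ℝ) ≤ K := by exact_mod_cast hK1
  have hKN' : (K : ℝ) ≤ N := by exact_mod_cast hKN
  have hN0 : (0 : ℝ) < N := by linarith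
  have hcard : Fintype.card (TestIdx L r C T) = T * C * (L + r) := by
    simp only [Fintype.card_prod, Fintype.card_fin]; ring
  refine ⟨hcard, ?_, ?_, fun S hS => ?_⟩
  · rw [hcard]
    push_cast
    calc (T : ℝ) * C * (L + r) ≤ ζ * K * C * (logb 2 ((N : ℝ) / K) + ε * logb 2 K) := by gcongr
      _ = _ := by ring
  · have h1 : logb 2 ((N : ℝ) / K) ≤ logb 2 N :=
      Real.logb_le_logb_of_le (by norm_num) (by positivity) (div_le_self (by positivity) hK1')
    have h2 : logb 2 (K : ℝ) ≤ logb 2 N :=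
      Real.logb_le_logb_of_le (by norm_num) (by positivity) hKN'
    have h3 : 0 ≤ logb 2 (K : ℝ) := Real.logb_nonneg (by norm_num) hK1'
    have h4 : 0 ≤ logb 2 (N : ℝ) := h3.trans h2
    have h5 : 0 ≤ logb 2 ((N : ℝ) / K) := le_trans (by positivity) hLle
    have hlogN : 0 ≤ log N := Real.log_nonneg (by linarith)
    calc ζ * C * K * (logb 2 ((N : ℝ) / K) + ε * logb 2 K)
        ≤ ζ * (|B| * ε⁻¹) * K * (logb 2 N + |B| * logb 2 N) := by gcongr
      _ = (D - 1) * ε⁻¹ * K * log N := by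
          rw [hD, logb]; field_simp; ring
      _ ≤ D * ε⁻¹ * K * log N := by
          gcongr; linarith
  · have hρ1 : ρ ≤ 1 := by
      have h1 := Real.exp_one_gt_d9
      have h2 : 0 < 1 / ζ := by positivity
      nlinarith
    have := isProbabilityMeasure_schemeLaw hρ hρ1 hTpos L r C N
    have hSp : ρ + S.card / T ≤ 2 * exp 1 * (ρ + 1 / ζ) / 4 := by
      refine le_trans ?_ hp
      gcongr
    refine le_trans (measureReal_mono ?_ (measure_ne_top _ _))
      ((schemeLaw_exposed_badChain_le (C := C) hρ hρ1 hTpos hS hNlt hrpos hSp (by linarith)).trans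
        (failure_le hε hC hq hρζ hK1 hrle hrlt rfl hLY))
    intro ω hω
    by_contra hgood
    refine hω ?_
    have hG : AllGood ω.1 (observed ω.1 ω.2 S) S := fun a ha i hi hb => hgood ⟨a, ha, i, hi, hb⟩
    refine ⟨densityEstimate_eq hrpos hG, decodesWithin hrpos hLpos hG hS hNlt hTW hrW hW ?_⟩
    refine htime.trans ?_
    rw [mul_assoc]
    exact le_mul_of_one_le_left (by positivity) hD1
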